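/- **Setting.** Let $d\ge 0$, $0\le \ell\le d<n$, and let $\mathbb F_q$ be a finite field ($q$ any prime power) with $q>n$. Entropy $H$ and mutual information $I$ are in base $q$. An $(n,k,d,\ell)$ *Type-II secure exact-repair regenerating code* with parameters $(\alpha,\beta,F_{\mathsf s})$ maps a secure message $S$ with $H(S)=F_{\mathsf s}$ (using random keys, which are uniform and independent of $S$) to node contents $N_1,\dots,N_n$ with $H(N_i)\le\alpha$, together with repair data $R_{h\to f}$ ($h\ne f$) such that: (i) $H(S\mid N_i,\ i\in\mathcal K)=0$ whenever $|\mathcal K|=k$; (ii) $H(R_{h\to f}\mid N_h)=0$, $H(R_{h\to f})\le\beta$, and $H(N_f\mid R_{h\to f},\ h\in\mathcal H)=0$ for all $\mathcal H\subseteq[n]\setminus\{f\}$ with $|\mathcal H|=d$; (iii) $I(S;\{R_{h\to i}: i\in\mathcal L,\ h\in[n]\setminus\{i\}\})=0$ for all $\mathcal L\subseteq[n]$ with $|\mathcal L|\le\ell$. A real tuple $(\alpha,\beta,F_{\mathsf s})$ is *achievable* over $\mathbb F_q$ if for every $\varepsilon>0$ there are an integer $T\ge 1$ and such a code, whose message,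 keys, node contents and repair data are vectors over $\mathbb F_q$ (the message uniform), with parameters $(T\alpha,T\beta,F')$, $F'\ge T(F_{\mathsf s}-\varepsilon)$. **Construction** for a mode $m\in[d]$. Let $\mathrm{ind}_{\mathcal I}(x)=|\{y\in \mathcal I:y\le x\}|$. The message matrix $\mathbf M$ has rows $x\in[d]$ and columns $\mathcal I\subseteq[d]$, $|\mathcal I|=m$. Each position $(x,\mathcal I)$ with $x\le\max\mathcal I$ holds a secure file symbol if it lies in the bottom-right block ($x>\ell$ and $\mathcal I\subseteq[\ell+1:d]$), and a random key otherwise; all these symbols are independent and uniform on $\mathbb F_q$. Each position with $x>\max\mathcal I$ holds the parity symbol $(-1)^m\sum_{y\in\mathcal I}(-1)^{\mathrm{ind}_{\mathcal I}(y)}\mathbf M(y,(\mathcal I\cup\{x\})\setminus\{y\})$. Let $\mathbf\Psi(i,j)=x_i^{j-1}$ be the $n\times d$ Vandermonde matrix of distinct non-zero $x_1,\dots,x_n\in\mathbb F_q$. Node $i$ stores the row $N_i$ of $\mathbf\Psi\mathbf M$, and $R_{h\to f}=N_h\,\mathbf\Xi^f$, where $\mathbf\Xi^f(\mathcal I,\mathcal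 J)=(-1)^{\mathrm{ind}_{\mathcal I}(y)}\mathbf\Psi(f,y)$ if $\mathcal I=\mathcal J\cup\{y\}$ (with $|\mathcal J|=m-1$), and $0$ if there is no such $y$. **Theorem.** Distinct non-zero $x_1,\dots,x_n\in\mathbb F_q$ exist, and for every choice of them: 1. For every $m\in[d]$ this code is an $(n,k=d,d,\ell)$ Type-II secure exact-repair regenerating code with $$\alpha^{(m)}=\binom dm,\qquad \beta^{(m)}=\binom{d-1}{m-1},\qquad F^{(m)}_{\mathsf s,\mathsf{II}}=m\binom{d-\ell+1}{m+1}$$ (the file size is $0$ when $m>d-\ell$). Moreover $\operatorname{rank}\mathbf\Xi^f=\beta^{(m)}$ for every $f$; for any $d$ distinct nodes $\mathcal H$, $\mathbf M=\mathbf\Psi(\mathcal H,:)^{-1}(\mathbf\Psi\mathbf M)(\mathcal H,:)$; and if $f\notin\mathcal H$, then $N_f(\mathcal I)=\sum_{y\in\mathcal I}(-1)^{\mathrm{ind}_{\mathcal I}(y)}\mathbf R^f(y,\mathcal I\setminus\{y\})$ for every $\mathcal I$, where $\mathbf R^f$ is $\mathbf\Psi(\mathcal H,:)^{-1}$ times the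 matrix with rows $R_{h\to f}$, $h\in\mathcal H$. 2. For any finite list of modes $m_1,\dots,m_r\in[d]$, using these codes side by side with independent messages and keys (and the same $x_i$) gives an $(n,d,d,\ell)$ Type-II secure exact-repair regenerating code with parameters $\sum_j(\alpha^{(m_j)},\beta^{(m_j)},F^{(m_j)}_{\mathsf s,\mathsf{II}})$. Finally, every tuple in the convex hull of $\{(\alpha^{(m)},\beta^{(m)},F^{(m)}_{\mathsf s,\mathsf{II}}):m\in[d]\}$ (in particular, in the convex hull of the tuples with $m\in[d-\ell]$) is achievable over $\mathbb F_q$. -/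

import Mathlib

open Finset Matrix

noncomputable section

/-! ## Entropy on a finite sample space with the uniform distribution -/

/-- Probability, under the uniform distribution on `Ω`, that `X` takes the value `a`. -/
def uniformProb {Ω A : Type*} [Finite Ω] (X : Ω → A) (a : A) : ℝ :=
  (Nat.card {ω : Ω // X ω = a} : ℝ) / (Nat.card Ω : ℝ)

/-- Shannon entropy `H(X) = 𝔼[-log_q ℙ(X = x)|_{x = X}]`, in base `q`, of a random variable `X`
on the sample space `Ω` with the uniform distribution. -/
def entropy {Ω A : Type*} [Finite Ω] (q : ℕ) (X : Ω → A) : ℝ :=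
  (∑ᶠ ω : Ω, -Real.logb (q : ℝ) (uniformProb X (X ω))) / (Nat.card Ω : ℝ)

/-- Conditional entropy `H(X | Y) = H(X, Y) - H(Y)`. -/
def condEntropy {Ω A B : Type*} [Finite Ω] (q : ℕ) (X : Ω → A) (Y : Ω → B) : ℝ :=
  entropy q (fun ω => (X ω, Y ω)) - entropy q Y

/-- Mutual information `I(X ; Y) = H(X) + H(Y) - H(X, Y)`. -/
def mutualInfo {Ω A B : Type*} [Finite Ω] (q : ℕ) (X : Ω → A) (Y : Ω → B) : ℝ :=
  entropy q X + entropy q Y - entropy q (fun ω => (X ω, Y ω))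

/-! ## Exact-repair regenerating codes and Type-II security -/

/-- The secure message `S`, the node contents `N i`, and the repair data `R h f` (sent by helper
node `h` to the failed node `f`) form an `(n, k, d)` exact-repair regenerating code with code
parameters `(Fs, α, β)`; sizes are measured in symbols of an alphabet with `q` elements.
The values `R f f` are irrelevant. -/
structure IsExactRepairCode {Ω A B C : Type*} [Finite Ω] (q n k d : ℕ) (α β Fs : ℝ)
    (S : Ω → A) (N : Fin n → Ω → B) (R : Fin n → Fin n → Ω → C) : Prop where
  /-- the message has size `Fs` -/
  message_size : entropy q S = Fs
  /-- every node stores at most `α` symbols -/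
  node_size : ∀ i, entropy q (N i) ≤ α
  /-- data recovery from any `k` nodes -/
  data_recovery : ∀ K : Finset (Fin n), K.card = k →
    condEntropy q S (fun ω (i : K) => N i ω) = 0
  /-- the repair data is computed from the content of the helper node -/
  repair_encoder : ∀ f h, h ≠ f → condEntropy q (R h f) (N h) = 0
  /-- at most `β` symbols are sent by each helper -/
  repair_size : ∀ f h, h ≠ f → entropy q (R h f) ≤ β
  /-- exact repair of any node by any `d` other nodes -/
  node_repair : ∀ f, ∀ H : Finset (Fin n), f ∉ H → H.card = d →
    condEntropy q (N f) (fun ω (h : H) => R h f ω) = 0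

/-- Type-II security against `ℓ` compromised nodes: the repair data that all other nodes can send
to the nodes of a set `L` with `|L| ≤ ℓ` is independent of the message. -/
def IsTypeIISecure {Ω A C : Type*} [Finite Ω] (q n ℓ : ℕ)
    (S : Ω → A) (R : Fin n → Fin n → Ω → C) : Prop :=
  ∀ L : Finset (Fin n), L.card ≤ ℓ →
    mutualInfo q S
      (fun ω (e : {e : Fin n × Fin n // e.2 ∈ L ∧ e.1 ≠ e.2}) => R e.1.1 e.1.2 ω) = 0

/-- There is an `(n, k, d, ℓ)` Type-II secure exact-repair regenerating code with parameters
`(Fs, α, β)` over the finite field `F`: message, random keys (uniform, and independent of each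
other and of the message), node contents and repair data are all vectors of symbols of `F`. -/
def ExistsTypeIISecureCode (F : Type*) [Fintype F] (n k d ℓ : ℕ) (α β Fs : ℝ) : Prop :=
  ∃ (σ κ ν ρ : Type) (_ : Finite σ) (_ : Finite κ) (_ : Finite ν) (_ : Finite ρ)
    (N : Fin n → (σ → F) × (κ → F) → (ν → F))
    (R : Fin n → Fin n → (σ → F) × (κ → F) → (ρ → F)),
    IsExactRepairCode (Fintype.card F) n k d α β Fs Prod.fst N R ∧
    IsTypeIISecure (Fintype.card F) n ℓ Prod.fst R

/-- Achievability of a real tuple `(α, β, Fs)` up to a common scaling: for every `ε > 0` and a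
suitable number `T` of units there is a code with per-node storage `T α`, repair bandwidth `T β`
and a secure message of at least `T (Fs - ε)` symbols. (The `ε` is only there because message
sizes are integers, while the entries of the tuple are arbitrary reals.) -/
def IsAchievable (F : Type*) [Fintype F] (n k d ℓ : ℕ) (α β Fs : ℝ) : Prop :=
  ∀ ε : ℝ, 0 < ε → ∃ T : ℕ, 0 < T ∧ ∃ Fs' : ℝ, (T : ℝ) * (Fs - ε) ≤ Fs' ∧
    ExistsTypeIISecureCode F n k d ℓ ((T : ℝ) * α) ((T : ℝ) * β) Fs'

/-! ## Secure determinant codes (Type II) -/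

/-- `ind_I(x) = |{y ∈ I : y ≤ x}|`. -/
def ind {d : ℕ} (I : Finset (Fin d)) (x : Fin d) : ℕ := (I.filter (fun y => y ≤ x)).card

/-- Column labels: subsets of `[d]` of size `m` (the rows `1, …, d` are `0, …, d - 1` here). -/
abbrev Col (d m : ℕ) : Type := {I : Finset (Fin d) // I.card = m}

/-- Positions `(x, I)` of type `𝒱`. -/
def TypeV {d m : ℕ} (p : Fin d × Col d m) : Prop := p.1 ∈ p.2.1

/-- Positions `(x, I)` of type `𝒲`: `x ∉ I` and `x < max I`. -/
def TypeW {d m : ℕ} (p : Fin d × Col d m) : Prop := p.1 ∉ p.2.1 ∧ ∃ y ∈ p.2.1, p.1 < y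

/-- The bottom right block of the message matrix: the rows `x > ℓ` (1-based) and the columns `I`
without an element `≤ ℓ`, which are the last `(d - ℓ).choose m` ones in lexicographic order. -/
def InBlockD {d m : ℕ} (ℓ : ℕ) (p : Fin d × Col d m) : Prop :=
  ℓ ≤ (p.1 : ℕ) ∧ ∀ y ∈ p.2.1, ℓ ≤ (y : ℕ)

/-- Positions of the secure file symbols: those of type `𝒱` or `𝒲` in the bottom right block. -/
abbrev SecurePos (d m ℓ : ℕ) : Type :=
  {p : Fin d × Col d m // (TypeV p ∨ TypeW p) ∧ InBlockD ℓ p}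

/-- Positions of the random keys: those of type `𝒱` or `𝒲` outside the bottom right block. -/
abbrev KeyPos (d m ℓ : ℕ) : Type :=
  {p : Fin d × Col d m // (TypeV p ∨ TypeW p) ∧ ¬ InBlockD ℓ p}

/-- The secure file symbols and the random keys of a secure determinant code of mode `m`. -/
abbrev Source (F : Type*) (d m ℓ : ℕ) : Type _ := (SecurePos d m ℓ → F) × (KeyPos d m ℓ → F)

/-- The column `(I ∪ {x}) \ {y}`, for `x ∉ I` and `y ∈ I`. -/
def swapCol {d m : ℕ} (I : Col d m) (x : Fin d) (hx : x ∉ I.1) (y : I.1) : Col d m :=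
  ⟨insert x (I.1.erase y), by
    have h : x ∉ I.1.erase y := fun h => hx (Finset.mem_of_mem_erase h)
    have hy := Finset.card_erase_add_one y.2
    rw [Finset.card_insert_of_notMem h, hy, I.2]⟩

/-- If `(x, I)` is neither of type `𝒱` nor of type `𝒲` then `(y, (I ∪ {x}) \ {y})` is of type `𝒲`
for every `y ∈ I`. -/
theorem typeW_swapCol {d m : ℕ} {x : Fin d} {I : Col d m} (h : ¬ (TypeV (x, I) ∨ TypeW (x, I)))
    (y : I.1) : TypeW ((y : Fin d), swapCol I x (fun hx => h (Or.inl hx)) y) := by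
  have hx : x ∉ I.1 := fun hx => h (Or.inl hx)
  have hne : (y : Fin d) ≠ x := fun e => hx (e ▸ y.2)
  have hyx : (y : Fin d) < x :=
    lt_of_le_of_ne (not_lt.1 fun hlt => h (Or.inr ⟨hx, y, y.2, hlt⟩)) hne
  refine ⟨?_, x, ?_, hyx⟩
  · simp [swapCol, hne]
  · simp [swapCol]

open Classical in
/-- The symbol placed at a position of type `𝒱` or `𝒲`. -/
def sourceSymbol {F : Type*} {d m ℓ : ℕ} (s : Source F d m ℓ) (p : Fin d × Col d m)
    (hp : TypeV p ∨ TypeW p) : F :=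
  if hD : InBlockD ℓ p then s.1 ⟨p, hp, hD⟩ else s.2 ⟨p, hp, hD⟩

open Classical in
/-- The `d × (d.choose m)` message matrix. The remaining positions (`x > max I`, type `𝒫`) hold the
parity symbols `(-1)^m ∑_{y ∈ I} (-1)^{ind_I(y)} M(y, (I ∪ {x}) \ {y})`. -/
def messageMatrix {F : Type*} [Field F] {d m ℓ : ℕ} (s : Source F d m ℓ) :
    Matrix (Fin d) (Col d m) F :=
  Matrix.of fun x I =>
    if h : TypeV (x, I) ∨ TypeW (x, I) then sourceSymbol s (x, I) h
    else (-1) ^ m * ∑ y : I.1, (-1) ^ ind I.1 y *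
      sourceSymbol s ((y : Fin d), swapCol I x (fun hx => h (Or.inl hx)) y)
        (Or.inr (typeW_swapCol h y))

/-- The `n × d` Vandermonde encoder matrix, with rows `(1, x_i, …, x_i^{d-1})`. -/
def encoderMatrix {F : Type*} [Field F] {n : ℕ} (d : ℕ) (x : Fin n → F) :
    Matrix (Fin n) (Fin d) F :=
  Matrix.of fun i j => x i ^ (j : ℕ)

/-- The code matrix; its `i`-th row is the content of node `i`. -/
def codeMatrix {F : Type*} [Field F] {n d m ℓ : ℕ} (x : Fin n → F) (s : Source F d m ℓ) :
    Matrix (Fin n) (Col d m) F :=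
  encoderMatrix d x * messageMatrix s

/-- The repair encoder matrix of node `f`: its entry at `(I, J)` is `(-1)^{ind_I(y)} Ψ(f, y)` if
`J ∪ {y} = I` (there is at most one such `y` when `m ≥ 1`), and `0` if there is no such `y`. -/
def repairEncoder {F : Type*} [Field F] {n : ℕ} (d m : ℕ) (x : Fin n → F) (f : Fin n) :
    Matrix (Col d m) (Col d (m - 1)) F :=
  Matrix.of fun I J =>
    ∑ y : Fin d, if insert y J.1 = I.1 then (-1) ^ ind I.1 y * encoderMatrix d x f y else 0

/-- The repair data sent by node `h` to node `f`: the content of node `h`, multiplied by the repair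
encoder matrix of node `f`. -/
def repairData {F : Type*} [Field F] {n d m ℓ : ℕ} (x : Fin n → F) (h f : Fin n)
    (s : Source F d m ℓ) : Col d (m - 1) → F :=
  Matrix.vecMul (codeMatrix x s h) (repairEncoder d m x f)

/-- The column label `I \ {y}` for `y ∈ I`. -/
def eraseCol {d m : ℕ} (I : Col d m) (y : I.1) : Col d (m - 1) :=
  ⟨I.1.erase y, by rw [Finset.card_erase_of_mem y.2, I.2]⟩

/-! ### Space sharing: several secure determinant codes of modes `μ 0, …, μ (r - 1)` side by side,
with independent messages and keys. -/

/-- The messages and the keys of all the component codes. -/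
abbrev SharedSource (F : Type*) (d ℓ : ℕ) {r : ℕ} (μ : Fin r → ℕ) : Type _ :=
  ((Σ j, SecurePos d (μ j) ℓ) → F) × ((Σ j, KeyPos d (μ j) ℓ) → F)

/-- The message and the keys of the `j`-th component code. -/
def SharedSource.component {F : Type*} {d ℓ r : ℕ} {μ : Fin r → ℕ} (s : SharedSource F d ℓ μ)
    (j : Fin r) : Source F d (μ j) ℓ :=
  (fun p => s.1 ⟨j, p⟩, fun p => s.2 ⟨j, p⟩)

/-- A node stores its content in each of the component codes. -/
def sharedNode {F : Type*} [Field F] {n d ℓ r : ℕ} {μ : Fin r → ℕ} (x : Fin n → F) (i : Fin n)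
    (s : SharedSource F d ℓ μ) : (Σ j, Col d (μ j)) → F :=
  fun c => codeMatrix x (s.component c.1) i c.2

/-- A helper sends its repair data in each of the component codes. -/
def sharedRepairData {F : Type*} [Field F] {n d ℓ r : ℕ} {μ : Fin r → ℕ} (x : Fin n → F)
    (h f : Fin n) (s : SharedSource F d ℓ μ) : (Σ j, Col d (μ j - 1)) → F :=
  fun c => repairData x h f (s.component c.1) c.2

end

/-! Let e_y be the standard basis of F^d and ψ_f row f of the encoder. Read a message matrix M as a
form M(a; b_1, …, b_m), linear in a and alternating in the b's, whose coefficients are the entries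
of M. The parity symbols are exactly what makes the alternatization of M over all m + 1 arguments
vanish (`isParity_iff`). Multiplying by the repair encoder of f is, up to sign, contraction of an
alternating form with ψ_f (`vecMul_repairEncoder`). So node f stores M(ψ_f; ·), and helper h sends
-M(ψ_h; ψ_f, ·).

Data recovery inverts a Vandermonde matrix. In the same way d helpers yield M(·; ψ_f, ·), and the
vanishing alternatization, evaluated at (ψ_f, e_I), expresses M(ψ_f; e_I) through it
(`IsParity.vecMul_eq_sum`). Contracting twice with ψ_f gives zero and the first coordinate of ψ_f is
1, so a contracted form is determined by its coefficients at columns without the first index; these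
are free, which gives the rank and β (`rank_repairEncoder`).

For security, take a linear map T that kills ψ_f for f in L and fixes e_y for y ≥ ℓ
(`exists_projection`). Pulling M back along T in all arguments preserves parity and the secure
block, and annihilates every contraction with ψ_f, f in L. Thus each message admits keys for which
the eavesdropper sees only zeros (`exists_keys`). All variables are linear, so entropies are ranks,
and this existence statement is equivalent to independence.

The file size is the size of the secure block minus its parity positions. Points of the convex hull
are approached by using rounded-down numbers of copies of each mode. -/

noncomputable section

/-! ## Increasing enumeration of column labels -/

/-- The increasing enumeration of a column label. -/
def Col.get {d m : ℕ} (I : Col d m) : Fin m ↪o Fin d := I.1.orderEmbOfFin I.2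

theorem Col.get_mem {d m : ℕ} (I : Col d m) (i : Fin m) : I.get i ∈ I.1 :=
  Finset.orderEmbOfFin_mem _ _ _

theorem Col.exists_get_eq {d m : ℕ} (I : Col d m) {y : Fin d} (hy : y ∈ I.1) :
    ∃ i, I.get i = y := by
  have : y ∈ Set.range (I.1.orderEmbOfFin I.2) := by rwa [Finset.range_orderEmbOfFin]
  exact this

theorem Col.get_unique {d m : ℕ} (I : Col d m) {f : Fin m → Fin d} (hf : StrictMono f)
    (h : ∀ i, f i ∈ I.1) : ⇑I.get = f :=
  (Finset.orderEmbOfFin_unique I.2 h hf).symm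

/-- Translates the signs of the construction into signs of positions in a sorted tuple. The shift by
one arises because `ind` counts the element itself while positions start at 0. -/
theorem ind_get {d m : ℕ} (I : Col d m) (i : Fin m) : ind I.1 (I.get i) = i + 1 := by
  have h : I.1.filter (fun y => y ≤ I.get i) = (Finset.Iic i).map I.get.toEmbedding := by
    ext y
    simp only [Finset.mem_filter, Finset.mem_map, Finset.mem_Iic, RelEmbedding.coe_toEmbedding]
    constructor
    · rintro ⟨hy, hle⟩
      obtain ⟨j, rfl⟩ := I.exists_get_eq hy
      exact ⟨j, I.get.le_iff_le.1 hle, rfl⟩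
    · rintro ⟨j, hj, rfl⟩
      exact ⟨I.get_mem j, I.get.le_iff_le.2 hj⟩
  rw [ind, h, Finset.card_map, Fin.card_Iic]

/-- The column label without its `i`-th element. -/
def Col.removeNth {d m : ℕ} (J : Col d (m + 1)) (i : Fin (m + 1)) : Col d m :=
  ⟨J.1.erase (J.get i), by rw [Finset.card_erase_of_mem (J.get_mem i), J.2]; rfl⟩

theorem Col.get_removeNth {d m : ℕ} (J : Col d (m + 1)) (i : Fin (m + 1)) :
    ⇑(J.removeNth i).get = J.get ∘ i.succAbove := by
  refine Col.get_unique _ (J.get.strictMono.comp (Fin.strictMono_succAbove i)) fun j => ?_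
  exact Finset.mem_erase.2 ⟨fun h => Fin.succAbove_ne i j (J.get.injective h), J.get_mem _⟩

/-! ## Alternating forms with prescribed coefficients -/

variable {F : Type*} [Field F]

/-- The increasing tuple of standard basis vectors labelled by `I`. -/
def stdTuple (F : Type*) [Field F] {d m : ℕ} (I : Col d m) : Fin m → Fin d → F :=
  fun i => Pi.single (I.get i) 1

theorem stdTuple_removeNth {d m : ℕ} (J : Col d (m + 1)) (i : Fin (m + 1)) :
    stdTuple F (J.removeNth i) = i.removeNth (stdTuple F J) := by
  funext j
  simp [stdTuple, Col.get_removeNth, Fin.removeNth]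

/-- The basis of the exterior power labelled by the columns. -/
def extBasis (F : Type*) [Field F] (d m : ℕ) : Module.Basis (Col d m) F (⋀[F]^m (Fin d → F)) :=
  ((Pi.basisFun F (Fin d)).exteriorPower m).reindex 
    ⟨fun I => ⟨I.1, I.2⟩, fun I => ⟨I.1, I.2⟩, fun _ => rfl, fun _ => rfl⟩

theorem extBasis_apply {d m : ℕ} (I : Col d m) :
    extBasis F d m I = exteriorPower.ιMulti F m (stdTuple F I) := by
  have h : extBasis F d m I = exteriorPower.ιMulti_family F m (Pi.basisFun F (Fin d))
      ⟨I.1, I.2⟩ := by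
    unfold extBasis
    rw [Module.Basis.reindex_apply]
    exact exteriorPower.basis_apply _ _ _ _
  rw [h]
  unfold exteriorPower.ιMulti_family
  congr 1
  funext i
  exact Pi.basisFun_apply F (Fin d) _

/-- The alternating form with coefficient `v I` at the increasing tuple of basis vectors
labelled by `I`, as a linear map in `v`. -/
def altFormLinear (F : Type*) [Field F] (d m : ℕ) :
    (Col d m → F) →ₗ[F] (Fin d → F) [⋀^Fin m]→ₗ[F] F :=
  (exteriorPower.alternatingMapLinearEquiv.symm.toLinearMap) ∘ₗ
    ((extBasis F d m).constr F).toLinearMap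

/-- The alternating form with coefficient `v I` at the increasing tuple of basis vectors
labelled by `I`. -/
abbrev altForm {d m : ℕ} (v : Col d m → F) : (Fin d → F) [⋀^Fin m]→ₗ[F] F :=
  altFormLinear F d m v

theorem altForm_stdTuple {d m : ℕ} (v : Col d m → F) (I : Col d m) :
    altForm v (stdTuple F I) = v I := by
  have h : altForm v (stdTuple F I) =
      (extBasis F d m).constr F v (exteriorPower.ιMulti F m (stdTuple F I)) := by
    change exteriorPower.alternatingMapLinearEquiv.symm _ _ = _
    rw [exteriorPower.alternatingMapLinearEquiv_symm_apply]
    rfl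
  rw [h, ← extBasis_apply]
  exact Module.Basis.constr_basis _ _ _ _

theorem alternating_ext {d m : ℕ} {A B : (Fin d → F) [⋀^Fin m]→ₗ[F] F}
    (h : ∀ I : Col d m, A (stdTuple F I) = B (stdTuple F I)) : A = B := by
  apply exteriorPower.alternatingMapLinearEquiv.injective
  apply (extBasis F d m).ext
  intro I
  rw [extBasis_apply]
  simpa using h I

theorem altForm_vecCons {d m : ℕ} (v : Col d (m + 1) → F) (a : Fin d → F)
    (b : Fin m → Fin d → F) :
    altForm v (vecCons a b) = ∑ y, a y * altForm v (vecCons (Pi.single y 1) b) := by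
  let φ : (Fin d → F) →ₗ[F] F :=
    { toFun := fun a => (altForm v).curryLeft a b
      map_add' := fun a a' => by rw [map_add]; rfl
      map_smul' := fun c a => by rw [map_smul]; rfl }
  have h : φ a = ∑ y, a y * φ (Pi.single y 1) := by
    conv_lhs => rw [pi_eq_sum_univ' a]
    rw [map_sum]
    refine Finset.sum_congr rfl fun y _ => ?_
    rw [map_smul, smul_eq_mul]
  exact h

/-- If y lies in J, an argument is repeated and both sides vanish. Otherwise, moving e_y from the
front to its sorted place i costs (-1)^i, which is -(-1)^ind. At most one column contributes to the
sum. -/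
theorem altForm_vecCons_single {d m : ℕ} (v : Col d (m + 1) → F) (J : Col d m) (y : Fin d) :
    altForm v (vecCons (Pi.single y 1) (stdTuple F J)) =
      -∑ I : Col d (m + 1), if insert y J.1 = I.1 then (-1) ^ ind I.1 y * v I else 0 := by
  by_cases hy : y ∈ J.1
  · obtain ⟨j, rfl⟩ := J.exists_get_eq hy
    rw [(altForm v).map_eq_zero_of_eq (i := 0) (j := j.succ) _ (by simp [stdTuple])
      (Fin.succ_ne_zero j).symm]
    rw [Finset.sum_eq_zero, neg_zero]
    intro I _
    rw [if_neg]
    intro h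
    rw [Finset.insert_eq_self.2 hy] at h
    have := I.2
    rw [← h, J.2] at this
    omega
  · let I : Col d (m + 1) := ⟨insert y J.1, by rw [Finset.card_insert_of_notMem hy, J.2]⟩
    obtain ⟨i, hi⟩ := I.exists_get_eq (Finset.mem_insert_self y J.1)
    have hJ : I.removeNth i = J := by
      apply Subtype.ext
      change (insert y J.1).erase (I.get i) = J.1
      rw [hi, Finset.erase_insert hy]
    rw [Finset.sum_eq_single I]
    · rw [if_pos rfl, ← hJ, ← hi, ind_get, stdTuple_removeNth]
      have h := AlternatingMap.neg_one_pow_smul_map_insertNth (altForm v) i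
        (Pi.single (I.get i) 1) (i.removeNth (stdTuple F I))
      rw [← h]
      have h2 : i.insertNth (Pi.single (I.get i) 1) (i.removeNth (stdTuple F I)) =
          stdTuple F I := Fin.insertNth_self_removeNth i (stdTuple F I)
      rw [h2, altForm_stdTuple, pow_succ]
      simp
    · intro I' _ hne
      rw [if_neg]
      exact fun h => hne (Subtype.ext h.symm)
    · simp

/-- The repair encoder is minus the contraction with row f of the encoder: expand that row in the
standard basis. -/
theorem vecMul_repairEncoder {n d m : ℕ} (x : Fin n → F) (f : Fin n) (v : Col d (m + 1) → F)
    (J : Col d m) :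
    Matrix.vecMul v (repairEncoder d (m + 1) x f) J =
      -altForm v (vecCons (encoderMatrix d x f) (stdTuple F J)) := by
  rw [altForm_vecCons]
  simp_rw [altForm_vecCons_single, Matrix.vecMul, dotProduct, repairEncoder, Matrix.of_apply,
    Finset.mul_sum]
  rw [Finset.sum_comm, ← Finset.sum_neg_distrib]
  refine Finset.sum_congr rfl fun y _ => ?_
  rw [mul_neg, neg_neg, Finset.mul_sum]
  refine Finset.sum_congr rfl fun I _ => ?_
  split_ifs <;> ring

/-! ## The parity equations -/

/-- The form, linear in the first argument and alternating in the others, whose coefficients are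
the entries of `M`. -/
def matrixForm {d m : ℕ} (M : Matrix (Fin d) (Col d m) F) :
    (Fin d → F) →ₗ[F] (Fin d → F) [⋀^Fin m]→ₗ[F] F :=
  altFormLinear F d m ∘ₗ M.vecMulLinear

theorem matrixForm_single {d m : ℕ} (M : Matrix (Fin d) (Col d m) F) (y : Fin d) :
    matrixForm M (Pi.single y 1) = altForm (M y) := by
  simp [matrixForm]
  rfl

/-- The parity equations of a message matrix. -/
def IsParity {d m : ℕ} (M : Matrix (Fin d) (Col d m) F) : Prop :=
  ∀ J : Col d (m + 1), ∑ i : Fin (m + 1), (-1) ^ (i : ℕ) * M (J.get i) (J.removeNth i) = 0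

theorem alternatize_matrixForm_stdTuple {d m : ℕ} (M : Matrix (Fin d) (Col d m) F)
    (J : Col d (m + 1)) :
    AlternatingMap.alternatizeUncurryFin (matrixForm M) (stdTuple F J) =
      ∑ i : Fin (m + 1), (-1) ^ (i : ℕ) * M (J.get i) (J.removeNth i) := by
  rw [AlternatingMap.alternatizeUncurryFin_apply]
  refine Finset.sum_congr rfl fun i _ => ?_
  rw [← stdTuple_removeNth]
  conv_lhs => rw [show stdTuple F J i = Pi.single (J.get i) 1 from rfl]
  rw [matrixForm_single, altForm_stdTuple]
  simp

theorem isParity_iff {d m : ℕ} (M : Matrix (Fin d) (Col d m) F) :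
    IsParity M ↔ AlternatingMap.alternatizeUncurryFin (matrixForm M) = 0 := by
  constructor
  · intro h
    apply alternating_ext
    intro J
    rw [alternatize_matrixForm_stdTuple, h J]
    rfl
  · intro h J
    rw [← alternatize_matrixForm_stdTuple, h]
    rfl

/-! ## The message matrix -/

/-- Splitting the largest element off an (m + 1)-set J produces exactly the parity positions. Hence
each parity equation has one parity symbol, its last term, and all its other terms are source
symbols of type 𝒲. -/
theorem not_source_last {d m : ℕ} (J : Col d (m + 1)) :
    ¬ (TypeV (J.get (Fin.last m), J.removeNth (Fin.last m)) ∨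
      TypeW (J.get (Fin.last m), J.removeNth (Fin.last m))) := by
  rintro (h | ⟨-, y, hy, hlt⟩)
  · exact Finset.notMem_erase _ _ h
  · obtain ⟨i, rfl⟩ := J.exists_get_eq (Finset.mem_of_mem_erase hy)
    exact absurd (J.get.lt_iff_lt.1 hlt) (not_lt.2 (Fin.le_last i))

theorem typeW_castSucc {d m : ℕ} (J : Col d (m + 1)) (i : Fin m) :
    TypeW (J.get i.castSucc, J.removeNth i.castSucc) := by
  refine ⟨Finset.notMem_erase _ _, J.get (Fin.last m), ?_, J.get.lt_iff_lt.2 i.castSucc_lt_last⟩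
  refine Finset.mem_erase.2 ⟨fun h => ?_, J.get_mem _⟩
  exact (i.castSucc_lt_last).ne' (J.get.injective h)

theorem exists_eq_last_of_not_source {d m : ℕ} {x : Fin d} {I : Col d m}
    (h : ¬ (TypeV (x, I) ∨ TypeW (x, I))) :
    ∃ J : Col d (m + 1), J.get (Fin.last m) = x ∧ J.removeNth (Fin.last m) = I := by
  have hx : x ∉ I.1 := fun hx => h (Or.inl hx)
  let J : Col d (m + 1) := ⟨insert x I.1, by rw [Finset.card_insert_of_notMem hx, I.2]⟩
  obtain ⟨i, hi⟩ := J.exists_get_eq (Finset.mem_insert_self x I.1)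
  have hlast : J.get (Fin.last m) = x := by
    rcases Finset.mem_insert.1 (J.get_mem (Fin.last m)) with h1 | h1
    · exact h1
    · refine (le_antisymm ?_ ?_).symm
      · rw [← hi]
        exact J.get.le_iff_le.2 (Fin.le_last i)
      · exact not_lt.1 fun hlt => h (Or.inr ⟨hx, _, h1, hlt⟩)
  refine ⟨J, hlast, Subtype.ext ?_⟩
  change (insert x I.1).erase (J.get (Fin.last m)) = I.1
  rw [hlast, Finset.erase_insert hx]

theorem Col.get_removeNth_last {d m : ℕ} (J : Col d (m + 1)) (i : Fin m) :
    (J.removeNth (Fin.last m)).get i = J.get i.castSucc := by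
  rw [Col.get_removeNth]
  simp

theorem swapCol_last {d m : ℕ} (J : Col d (m + 1)) (h) (i : Fin m) (hy) :
    swapCol (J.removeNth (Fin.last m)) (J.get (Fin.last m)) h
      ⟨(J.removeNth (Fin.last m)).get i, hy⟩ = J.removeNth i.castSucc := by
  apply Subtype.ext
  have hne : J.get (Fin.last m) ≠ J.get i.castSucc := fun e =>
    (i.castSucc_lt_last).ne' (J.get.injective e)
  change insert (J.get (Fin.last m)) (((J.1).erase (J.get (Fin.last m))).erase
    ((J.removeNth (Fin.last m)).get i)) = J.1.erase (J.get i.castSucc)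
  rw [Col.get_removeNth_last, Finset.erase_right_comm, Finset.insert_erase]
  exact Finset.mem_erase.2 ⟨hne, J.get_mem _⟩

theorem messageMatrix_of_source {d m ℓ : ℕ} (s : Source F d m ℓ) {x : Fin d} {I : Col d m}
    (h : TypeV (x, I) ∨ TypeW (x, I)) : messageMatrix s x I = sourceSymbol s (x, I) h := by
  rw [messageMatrix, Matrix.of_apply, dif_pos h]

theorem messageMatrix_of_not_source {d m ℓ : ℕ} (s : Source F d m ℓ) {x : Fin d} {I : Col d m}
    (h : ¬ (TypeV (x, I) ∨ TypeW (x, I))) :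
    messageMatrix s x I = (-1) ^ m * ∑ y : I.1, (-1) ^ ind I.1 y *
      sourceSymbol s ((y : Fin d), swapCol I x (fun hx => h (Or.inl hx)) y)
        (Or.inr (typeW_swapCol h y)) := by
  rw [messageMatrix, Matrix.of_apply, dif_neg h]

theorem messageMatrix_last {d m ℓ : ℕ} (s : Source F d m ℓ) (J : Col d (m + 1)) :
    messageMatrix s (J.get (Fin.last m)) (J.removeNth (Fin.last m)) =
      (-1) ^ m * ∑ i : Fin m, (-1) ^ ((i : ℕ) + 1) *
        messageMatrix s (J.get i.castSucc) (J.removeNth i.castSucc) := by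
  rw [messageMatrix_of_not_source s (not_source_last J)]
  congr 1
  rw [← Equiv.sum_comp (((J.removeNth (Fin.last m)).1).orderIsoOfFin
    (J.removeNth (Fin.last m)).2).toEquiv]
  refine Finset.sum_congr rfl fun i _ => ?_
  have hy := (J.removeNth (Fin.last m)).get_mem i
  have he : (((J.removeNth (Fin.last m)).1).orderIsoOfFin
    (J.removeNth (Fin.last m)).2).toEquiv i = ⟨(J.removeNth (Fin.last m)).get i, hy⟩ := rfl
  have hs : ∀ (p q : Fin d × Col d m) (hp : TypeV p ∨ TypeW p) (hq : TypeV q ∨ TypeW q),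
      p = q → sourceSymbol s p hp = sourceSymbol s q hq := by
    rintro p q hp hq rfl
    rfl
  rw [he, messageMatrix_of_source s (Or.inr (typeW_castSucc J i))]
  congr 1
  · rw [ind_get]
  · exact hs _ _ _ _ (Prod.ext (J.get_removeNth_last i) (swapCol_last J (Finset.notMem_erase _ _) i hy))

theorem isParity_iff_last {d m : ℕ} (M : Matrix (Fin d) (Col d m) F) :
    IsParity M ↔ ∀ J : Col d (m + 1), M (J.get (Fin.last m)) (J.removeNth (Fin.last m)) =
      (-1) ^ m * ∑ i : Fin m, (-1) ^ ((i : ℕ) + 1) *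
        M (J.get i.castSucc) (J.removeNth i.castSucc) := by
  refine forall_congr' fun J => ?_
  rw [Fin.sum_univ_castSucc]
  simp only [pow_succ, Fin.val_castSucc, Fin.val_last, mul_neg, neg_mul, mul_one,
    Finset.sum_neg_distrib]
  have h : ((-1 : F) ^ m) * (-1) ^ m = 1 := by rw [← mul_pow]; simp
  constructor
  · intro h1
    linear_combination (-1) ^ m * h1 - M (J.get (Fin.last m)) (J.removeNth (Fin.last m)) * h
  · intro h1
    linear_combination (-1) ^ m * h1 - (∑ i : Fin m, (-1) ^ (i : ℕ) *
      M (J.get i.castSucc) (J.removeNth i.castSucc)) * h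

theorem isParity_messageMatrix {d m ℓ : ℕ} (s : Source F d m ℓ) : IsParity (messageMatrix s) :=
  (isParity_iff_last _).2 (messageMatrix_last s)

/-- Each parity equation can be solved for its last entry, whose coefficient is a sign, in terms of
source entries. -/
theorem IsParity.ext {d m : ℕ} {M M' : Matrix (Fin d) (Col d m) F} (hM : IsParity M)
    (hM' : IsParity M') (h : ∀ x I, TypeV (x, I) ∨ TypeW (x, I) → M x I = M' x I) : M = M' := by
  ext x I
  by_cases hs : TypeV (x, I) ∨ TypeW (x, I)
  · exact h x I hs
  · obtain ⟨J, rfl, rfl⟩ := exists_eq_last_of_not_source hs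
    rw [(isParity_iff_last M).1 hM, (isParity_iff_last M').1 hM']
    congr 1
    refine Finset.sum_congr rfl fun i _ => ?_
    rw [h _ _ (Or.inr (typeW_castSucc J i))]

/-! ### Sources correspond bijectively and linearly to matrices satisfying the parity equations -/

/-- The secure symbols and the keys which appear in a matrix. -/
def matrixSource {d m : ℕ} (ℓ : ℕ) (M : Matrix (Fin d) (Col d m) F) : Source F d m ℓ :=
  (fun p => M p.1.1 p.1.2, fun p => M p.1.1 p.1.2)

theorem messageMatrix_matrixSource {d m : ℕ} (ℓ : ℕ) {M : Matrix (Fin d) (Col d m) F}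
    (hM : IsParity M) : messageMatrix (matrixSource ℓ M) = M := by
  refine (isParity_messageMatrix _).ext hM fun x I h => ?_
  rw [messageMatrix_of_source _ h, sourceSymbol]
  split_ifs <;> rfl

theorem matrixSource_messageMatrix {d m ℓ : ℕ} (s : Source F d m ℓ) :
    matrixSource ℓ (messageMatrix s) = s := by
  refine Prod.ext (funext fun p => ?_) (funext fun p => ?_)
  · change messageMatrix s p.1.1 p.1.2 = s.1 p
    rw [messageMatrix_of_source s p.2.1, sourceSymbol, dif_pos p.2.2]
  · change messageMatrix s p.1.1 p.1.2 = s.2 p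
    rw [messageMatrix_of_source s p.2.1, sourceSymbol, dif_neg p.2.2]

theorem IsParity.add {d m : ℕ} {M M' : Matrix (Fin d) (Col d m) F} (hM : IsParity M)
    (hM' : IsParity M') : IsParity (M + M') := by
  intro J
  have := congrArg₂ (· + ·) (hM J) (hM' J)
  simpa [mul_add, Finset.sum_add_distrib] using this

theorem IsParity.smul {d m : ℕ} {M : Matrix (Fin d) (Col d m) F} (c : F) (hM : IsParity M) :
    IsParity (c • M) := by
  intro J
  have := congrArg (c * ·) (hM J)
  simpa [Finset.mul_sum, mul_left_comm] using this

/-- The message matrix as a linear function of the secure symbols and the keys. -/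
def messageMatrixLinear (F : Type*) [Field F] (d m ℓ : ℕ) :
    Source F d m ℓ →ₗ[F] Matrix (Fin d) (Col d m) F where
  toFun := messageMatrix
  map_add' s s' := by
    -- Linearity comes from the inverse: the sum is again a parity matrix, hence the message matrix
    -- of its own source, and reading off the source is additive.
    rw [← messageMatrix_matrixSource ℓ
      ((isParity_messageMatrix s).add (isParity_messageMatrix s'))]
    congr 1
    conv_lhs => rw [← matrixSource_messageMatrix s, ← matrixSource_messageMatrix s']
    rfl
  map_smul' c s := by
    rw [RingHom.id_apply, ← messageMatrix_matrixSource ℓ ((isParity_messageMatrix s).smul c)]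
    congr 1
    conv_lhs => rw [← matrixSource_messageMatrix s]
    rfl

/-! ## Data recovery and node repair -/

theorem isUnit_det_encoderMatrix {n d : ℕ} {x : Fin n → F} (hx : Function.Injective x)
    {e : Fin d → Fin n} (he : Function.Injective e) :
    IsUnit ((encoderMatrix d x).submatrix e id).det := by
  have h : (encoderMatrix d x).submatrix e id = Matrix.vandermonde (x ∘ e) := by
    ext i j
    rfl
  rw [h, isUnit_iff_ne_zero]
  exact Matrix.det_vandermonde_ne_zero_iff.2 (hx.comp he)

theorem inv_encoderMatrix_mul {n d : ℕ} {C : Type*} {x : Fin n → F} (hx : Function.Injective x)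
    {e : Fin d → Fin n} (he : Function.Injective e) (M : Matrix (Fin d) C F) :
    ((encoderMatrix d x).submatrix e id)⁻¹ * (encoderMatrix d x * M).submatrix e id = M := by
  have h : (encoderMatrix d x * M).submatrix e id = (encoderMatrix d x).submatrix e id * M := by
    ext i j
    rfl
  rw [h, Matrix.nonsing_inv_mul_cancel_left _ _ (isUnit_det_encoderMatrix hx he)]

theorem repairData_eq {n d m ℓ : ℕ} (x : Fin n → F) (h f : Fin n) (s : Source F d m ℓ) :
    repairData x h f s = (encoderMatrix d x * (messageMatrix s * repairEncoder d m x f)) h := by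
  rw [← Matrix.mul_assoc]
  rfl

theorem removeNth_succ_vecCons {α : Type*} {m : ℕ} (a : α) (b : Fin (m + 1) → α)
    (i : Fin (m + 1)) : i.succ.removeNth (vecCons a b) = vecCons a (i.removeNth b) := by
  funext j
  refine Fin.cases ?_ (fun j => ?_) j <;> simp [Fin.removeNth]

/-- The content of a node, in terms of the message matrix multiplied by its repair encoder. -/
theorem IsParity.vecMul_eq_sum {n d m : ℕ} {M : Matrix (Fin d) (Col d (m + 1)) F}
    (hM : IsParity M) (x : Fin n → F) (f : Fin n) (I : Col d (m + 1)) :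
    Matrix.vecMul (encoderMatrix d x f) M I =
      ∑ y : I.1, (-1) ^ ind I.1 y * (M * repairEncoder d (m + 1) x f) y (eraseCol I y) := by
  -- Evaluate the alternatization at (ψ_f, e_I). The term with ψ_f in the linear slot is the node
  -- content; in every other term ψ_f leads the alternating slots, so that term is a contraction, an
  -- entry of `M * repairEncoder`.
  have h := congrArg (fun A => A (vecCons (encoderMatrix d x f) (stdTuple F I)))
    ((isParity_iff M).1 hM)
  simp only [AlternatingMap.alternatizeUncurryFin_apply] at h
  rw [Fin.sum_univ_succ] at h
  have h0 : matrixForm M (encoderMatrix d x f) (stdTuple F I) =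
      Matrix.vecMul (encoderMatrix d x f) M I := altForm_stdTuple _ I
  have hs : ∀ i : Fin (m + 1), matrixForm M (stdTuple F I i)
      (vecCons (encoderMatrix d x f) (stdTuple F (I.removeNth i))) =
      -(M * repairEncoder d (m + 1) x f) (I.get i) (I.removeNth i) := by
    intro i
    have : stdTuple F I i = Pi.single (I.get i) 1 := rfl
    rw [this, matrixForm_single, ← neg_eq_iff_eq_neg, ← vecMul_repairEncoder]
    rfl
  simp only [removeNth_succ_vecCons, ← stdTuple_removeNth, Matrix.cons_val_succ, hs] at h
  have hz : (Fin.removeNth 0 (vecCons (encoderMatrix d x f) (stdTuple F I))) = stdTuple F I := rfl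
  rw [hz, Matrix.cons_val_zero, h0] at h
  rw [← Equiv.sum_comp (I.1.orderIsoOfFin I.2).toEquiv]
  have hr : ∀ i : Fin (m + 1), (-1) ^ ind I.1 ((I.1.orderIsoOfFin I.2).toEquiv i) *
      (M * repairEncoder d (m + 1) x f) ((I.1.orderIsoOfFin I.2).toEquiv i)
        (eraseCol I ((I.1.orderIsoOfFin I.2).toEquiv i)) =
      (-1) ^ ((i : ℕ) + 1) * (M * repairEncoder d (m + 1) x f) (I.get i) (I.removeNth i) := by
    intro i
    have he : (I.1.orderIsoOfFin I.2).toEquiv i = ⟨I.get i, I.get_mem i⟩ := rfl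
    rw [he, ind_get]
    rfl
  simp only [hr]
  have h' : Matrix.vecMul (encoderMatrix d x f) M I + ∑ i : Fin (m + 1), (-1) ^ ((i : ℕ) + 1) *
      -(M * repairEncoder d (m + 1) x f) (I.get i) (I.removeNth i) = 0 := by
    simpa using h
  simp only [mul_neg, Finset.sum_neg_distrib] at h'
  linear_combination h'

/-! ## The rank of the repair encoder -/

/-- Expanding a, the terms with y ≠ z involve only columns without z, where v vanishes. In the
remaining term z is the least element of I, so no sign appears. -/
theorem altForm_vecCons_of_notMem {d m : ℕ} {z : Fin d} (hz : ∀ y, z ≤ y)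
    (v : Col d (m + 1) → F) (hv : ∀ I : Col d (m + 1), z ∉ I.1 → v I = 0) (a : Fin d → F)
    (I : Col d (m + 1)) (J : Col d m) (hJ : z ∉ J.1) (hI : insert z J.1 = I.1) :
    altForm v (vecCons a (stdTuple F J)) = a z * v I := by
  rw [altForm_vecCons, Finset.sum_eq_single z]
  · rw [altForm_vecCons_single, Finset.sum_eq_single I]
    · have h1 : ind I.1 z = 1 := by
        rw [ind, Finset.card_eq_one]
        refine ⟨z, ?_⟩
        ext y
        rw [Finset.mem_filter, Finset.mem_singleton]
        constructor
        · exact fun h => le_antisymm h.2 (hz y)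
        · rintro rfl
          exact ⟨hI ▸ Finset.mem_insert_self _ _, le_rfl⟩
      rw [if_pos hI, h1]
      ring
    · intro I' _ hne
      rw [if_neg]
      exact fun h => hne (Subtype.ext (h.symm.trans hI))
    · simp
  · intro y _ hy
    rw [altForm_vecCons_single, Finset.sum_eq_zero, neg_zero, mul_zero]
    intro I' _
    split_ifs with h
    · rw [hv, mul_zero]
      rw [← h, Finset.mem_insert, not_or]
      exact ⟨hy.symm, hJ⟩
    · rfl
  · simp

theorem altForm_vecMul_repairEncoder {n d m : ℕ} (x : Fin n → F) (f : Fin n)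
    (v : Col d (m + 1) → F) :
    altForm (m := m) (Matrix.vecMul v (repairEncoder d (m + 1) x f)) =
      -(altForm v).curryLeft (encoderMatrix d x f) := by
  apply alternating_ext
  intro J
  rw [altForm_stdTuple, vecMul_repairEncoder]
  rfl

theorem encoderMatrix_zero {n d : ℕ} (x : Fin n → F) (f : Fin n) {z : Fin d}
    (hz : ∀ y, z ≤ y) : encoderMatrix d x f z = 1 := by
  have h : (z : ℕ) = 0 := Nat.le_zero.1 (hz ⟨0, z.pos⟩)
  rw [encoderMatrix, Matrix.of_apply, h, pow_zero]

/-- The repair data is determined by its entries at the columns without the first row index. -/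
theorem vecMul_repairEncoder_eq_zero {n d m : ℕ} (x : Fin n → F) (f : Fin n) {z : Fin d}
    (hz : ∀ y, z ≤ y) (v : Col d (m + 1) → F)
    (h : ∀ J : Col d m, z ∉ J.1 → Matrix.vecMul v (repairEncoder d (m + 1) x f) J = 0) :
    Matrix.vecMul v (repairEncoder d (m + 1) x f) = 0 := by
  funext (J : Col d m)
  by_cases hJ : z ∈ J.1
  · obtain ⟨i, hi⟩ := J.exists_get_eq hJ
    obtain ⟨m, rfl⟩ : ∃ k, m = k + 1 := ⟨m - 1, by have := i.pos; omega⟩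
    -- Contract the repair data once more with ψ_f. By the assumption on columns without z this
    -- isolates the entry at J, with coefficient 1; but ψ_f now occupies two alternating slots, so
    -- the result is 0.
    have h1 := altForm_vecCons_of_notMem hz _ h (encoderMatrix d x f) J (J.removeNth i)
      (by rw [← hi]; exact Finset.notMem_erase _ _)
      (by rw [← hi]; exact Finset.insert_erase (J.get_mem i))
    rw [altForm_vecMul_repairEncoder, encoderMatrix_zero x f hz, one_mul] at h1
    rw [← h1, AlternatingMap.neg_apply, AlternatingMap.curryLeft_apply_apply,
      (altForm v).map_eq_zero_of_eq (i := 0) (j := 1) _ (by simp) (by simp)]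
    simp
  · exact h J hJ

theorem exists_vecMul_repairEncoder_eq {n d m : ℕ} (x : Fin n → F) (f : Fin n) {z : Fin d}
    (hz : ∀ y, z ≤ y) (w : Col d m → F) :
    ∃ v : Col d (m + 1) → F, ∀ J : Col d m, z ∉ J.1 →
      Matrix.vecMul v (repairEncoder d (m + 1) x f) J = w J := by
  -- Support v on the columns containing z, so that each contracted coefficient has a single term.
  -- The sign of -w cancels the one in `vecMul_repairEncoder`.
  let v : Col d (m + 1) → F := fun I =>
    if h : z ∈ I.1 then -w ⟨I.1.erase z, by rw [Finset.card_erase_of_mem h, I.2]; rfl⟩ else 0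
  refine ⟨v, fun J hJ => ?_⟩
  have hz' : z ∈ insert z J.1 := Finset.mem_insert_self _ _
  rw [vecMul_repairEncoder, altForm_vecCons_of_notMem hz v (fun I hI => dif_neg hI) _
    ⟨insert z J.1, by rw [Finset.card_insert_of_notMem hJ, J.2]⟩ J hJ rfl,
    encoderMatrix_zero x f hz, one_mul]
  simp only [v]
  rw [dif_pos hz', neg_neg]
  congr 1
  exact Subtype.ext (Finset.erase_insert hJ)

/-- The column labels all of whose elements are at least `ℓ`. -/
abbrev HighCol (d m ℓ : ℕ) : Type := {I : Col d m // ∀ y ∈ I.1, ℓ ≤ (y : ℕ)}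

theorem card_fin_le (d ℓ : ℕ) : Nat.card {y : Fin d // ℓ ≤ (y : ℕ)} = d - ℓ := by
  have e : {y : Fin d // ℓ ≤ (y : ℕ)} ≃ Fin (d - ℓ) :=
    { toFun := fun y => ⟨y.1 - ℓ, by have := y.1.2; have := y.2; omega⟩
      invFun := fun y => ⟨⟨y + ℓ, by have := y.2; omega⟩, Nat.le_add_left _ _⟩
      left_inv := fun y => Subtype.ext (Fin.ext (Nat.sub_add_cancel y.2))
      right_inv := fun y => Fin.ext (Nat.add_sub_cancel _ _) }
  rw [Nat.card_congr e, Nat.card_fin]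

theorem card_highCol (d m ℓ : ℕ) : Nat.card (HighCol d m ℓ) = (d - ℓ).choose m := by
  have e : HighCol d m ℓ ≃
      ((Finset.univ.filter fun y : Fin d => ℓ ≤ (y : ℕ)).powersetCard m) :=
    { toFun := fun J => ⟨J.1.1, Finset.mem_powersetCard.2
        ⟨fun y hy => Finset.mem_filter.2 ⟨Finset.mem_univ y, J.2 y hy⟩, J.1.2⟩⟩
      invFun := fun J => ⟨⟨J.1, (Finset.mem_powersetCard.1 J.2).2⟩,
        fun y hy => (Finset.mem_filter.1 ((Finset.mem_powersetCard.1 J.2).1 hy)).2⟩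
      left_inv := fun _ => rfl
      right_inv := fun _ => rfl }
  rw [Nat.card_congr e, Nat.card_eq_fintype_card, Fintype.card_coe, Finset.card_powersetCard,
    ← Fintype.card_subtype, ← Nat.card_eq_fintype_card, card_fin_le]

theorem card_col (d m : ℕ) : Nat.card (Col d m) = d.choose m := by
  rw [← Nat.card_congr (Equiv.subtypeUnivEquiv (α := Col d m)
    (p := fun I => ∀ y ∈ I.1, 0 ≤ (y : ℕ)) fun I y _ => Nat.zero_le _)]
  exact card_highCol d m 0

theorem notMem_iff_one_le {d : ℕ} {z : Fin d} (hz : ∀ y, z ≤ y) (J : Finset (Fin d)) :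
    z ∉ J ↔ ∀ y ∈ J, 1 ≤ (y : ℕ) := by
  have h0 : (z : ℕ) = 0 := Nat.le_zero.1 (hz ⟨0, z.pos⟩)
  constructor
  · intro h y hy
    by_contra hlt
    have : y = z := Fin.ext (by omega)
    exact h (this ▸ hy)
  · intro h hzJ
    have := h z hzJ
    omega

theorem rank_repairEncoder {n d m : ℕ} (hd : 0 < d) (x : Fin n → F) (f : Fin n) :
    (repairEncoder d (m + 1) x f).rank = (d - 1).choose m := by
  have hz : ∀ y : Fin d, (⟨0, hd⟩ : Fin d) ≤ y := fun y => Nat.zero_le _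
  generalize (⟨0, hd⟩ : Fin d) = z at hz
  let V := LinearMap.range (repairEncoder d (m + 1) x f).vecMulLinear
  let ρ : V →ₗ[F] ({J : Col d m // z ∉ J.1} → F) :=
    LinearMap.funLeft F F (fun J => J.1) ∘ₗ V.subtype
  -- Restriction to the columns avoiding the first index identifies the row space with a full
  -- coordinate space.
  have hρ : Function.Bijective ρ := by
    constructor
    · rw [← LinearMap.ker_eq_bot, LinearMap.ker_eq_bot']
      rintro ⟨_, v, rfl⟩ h
      apply Subtype.ext
      exact vecMul_repairEncoder_eq_zero x f hz v fun J hJ => congrFun h ⟨J, hJ⟩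
    · intro w
      classical
      obtain ⟨v, hv⟩ := exists_vecMul_repairEncoder_eq x f hz
        (fun J : Col d m => if h : z ∉ J.1 then w ⟨J, h⟩ else 0)
      refine ⟨⟨_, v, rfl⟩, funext fun J => ?_⟩
      exact (hv J.1 J.2).trans (dif_pos J.2)
  have h := (LinearEquiv.ofBijective ρ hρ).finrank_eq
  rw [Module.finrank_fintype_fun_eq_card, ← Nat.card_eq_fintype_card, 
    Nat.card_congr (Equiv.subtypeEquivRight fun J : Col d m => notMem_iff_one_le hz J.1),
    card_highCol] at h
  rw [← h, ← Matrix.rank_transpose, Matrix.rank, Matrix.mulVecLin_transpose]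

/-! ## Security -/

theorem exists_projection {n d ℓ : ℕ} {x : Fin n → F} (hx : Function.Injective x)
    (hℓ : ℓ ≤ d) (L : Finset (Fin n)) (hL : L.card ≤ ℓ) :
    ∃ T : (Fin d → F) →ₗ[F] (Fin d → F), (∀ f ∈ L, T (encoderMatrix d x f) = 0) ∧
      ∀ y : Fin d, ℓ ≤ (y : ℕ) → T (Pi.single y 1) = Pi.single y 1 := by
  let P : Submodule F (Fin d → F) :=
    LinearMap.range (Fintype.linearCombination F (fun f : L => encoderMatrix d x f))
  let W : Submodule F (Fin d → F) :=
    { carrier := {v | ∀ y : Fin d, (y : ℕ) < ℓ → v y = 0}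
      add_mem' := fun {a b} ha hb y hy => by rw [Pi.add_apply, ha y hy, hb y hy, add_zero]
      zero_mem' := fun y hy => rfl
      smul_mem' := fun c a ha y hy => by rw [Pi.smul_apply, ha y hy, smul_zero] }
  -- A combination of the rows in L that vanishes on the first ℓ coordinates already vanishes on the
  -- first |L| of them; there the rows form a square Vandermonde matrix, so the coefficients are
  -- zero.
  have hWP : Disjoint W P := by
    rw [Submodule.disjoint_def]
    rintro _ hW ⟨c, rfl⟩
    have hc : c ∘ L.equivFin.symm = 0 := by
      refine Matrix.eq_zero_of_forall_pow_sum_mul_pow_eq_zero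
        (f := fun j => x (L.equivFin.symm j)) (fun i j h => ?_) fun i => ?_
      · exact L.equivFin.symm.injective (Subtype.ext (hx h))
      · have h := hW ⟨i, by omega⟩ (by have := i.2; simp only; omega)
        rw [Fintype.linearCombination_apply, Finset.sum_apply,
          ← Equiv.sum_comp L.equivFin.symm] at h
        exact h
    have hc' : c = 0 := by
      funext f
      have := congrFun hc (L.equivFin f)
      simpa using this
    rw [hc', map_zero]
  -- Enlarge W to a complement of P; the projection along P kills the rows in L and fixes W.
  obtain ⟨W', hW', hcompl⟩ := hWP.exists_isCompl
  refine ⟨Submodule.projection W' P hcompl, fun f hf => ?_, fun y hy => ?_⟩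
  · rw [Submodule.projection_apply_eq_zero_iff]
    classical
    exact ⟨Pi.single ⟨f, hf⟩ 1, by simp [Fintype.linearCombination_apply_single]⟩
  · apply Submodule.projection_apply_of_mem_left
    apply hW'
    intro z hz
    exact Pi.single_eq_of_ne (fun h => by subst h; omega) _

theorem exists_keys {n d m ℓ : ℕ} {x : Fin n → F} (hx : Function.Injective x) (hℓ : ℓ ≤ d)
    (L : Finset (Fin n)) (hL : L.card ≤ ℓ) (s₀ : SecurePos d (m + 1) ℓ → F) :
    ∃ s : Source F d (m + 1) ℓ, s.1 = s₀ ∧ ∀ f ∈ L, ∀ h, repairData x h f s = 0 := by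
  obtain ⟨T, hT, hT'⟩ := exists_projection (d := d) hx hℓ L hL
  -- The zero keys are an arbitrary starting point; the keys finally used are read off the
  -- pulled-back form `A`.
  let M₀ := messageMatrix (F := F) (d := d) (m := m + 1) (ℓ := ℓ) (s₀, 0)
  let A : (Fin d → F) →ₗ[F] (Fin d → F) [⋀^Fin (m + 1)]→ₗ[F] F :=
    { toFun := fun a => (matrixForm M₀ (T a)).compLinearMap T
      map_add' := fun a b => by rw [map_add, map_add]; rfl
      map_smul' := fun c a => by rw [map_smul, map_smul]; rfl }
  let M : Matrix (Fin d) (Col d (m + 1)) F :=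
    Matrix.of fun y I => A (Pi.single y 1) (stdTuple F I)
  have hrow : ∀ y, altForm (M y) = A (Pi.single y 1) := by
    intro y
    apply alternating_ext
    intro I
    rw [altForm_stdTuple]
    rfl
  have hMA : matrixForm M = A := by
    apply LinearMap.pi_ext'
    intro y
    ext1
    simpa [matrixForm_single] using hrow y
  have hM : IsParity M := by
    rw [isParity_iff, hMA]
    ext v
    -- Alternatization commutes with pulling back all arguments along the same map T, so parity
    -- survives.
    have h := congrArg (fun B => B (T ∘ v))
      ((isParity_iff M₀).1 (isParity_messageMatrix (s₀, 0)))
    simp only [AlternatingMap.alternatizeUncurryFin_apply] at h ⊢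
    exact h
  refine ⟨matrixSource ℓ M, funext fun p => ?_, fun f hf h => ?_⟩
  · obtain ⟨⟨y, I⟩, hp, hy, hI⟩ := p
    have h1 : (matrixSource ℓ M).1 ⟨(y, I), hp, hy, hI⟩ =
        matrixForm M₀ (T (Pi.single y 1)) (T ∘ stdTuple F I) := rfl
    -- In the secure block every index is at least ℓ, so T fixes all arguments and the file symbol
    -- is unchanged.
    have h2 : T ∘ stdTuple F I = stdTuple F I :=
      funext fun i => hT' (I.get i) (hI _ (I.get_mem i))
    have h3 : M₀ y I = sourceSymbol (s₀, 0) (y, I) hp := messageMatrix_of_source _ hp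
    rw [h1, h2, hT' y hy, matrixForm_single, altForm_stdTuple, h3, sourceSymbol, dif_pos ⟨hy, hI⟩]
  · have h0 : M * repairEncoder d (m + 1) x f = 0 := by
      ext y (J : Col d m)
      have h1 : (M * repairEncoder d (m + 1) x f) y J =
        Matrix.vecMul (M y) (repairEncoder d (m + 1) x f) J := rfl
      rw [h1, vecMul_repairEncoder, hrow]
      have h2 : A (Pi.single y 1) (vecCons (encoderMatrix d x f) (stdTuple F J)) =
        matrixForm M₀ (T (Pi.single y 1))
          (fun i => T (vecCons (encoderMatrix d x f) (stdTuple F J) i)) := rfl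
      rw [h2, AlternatingMap.map_coord_zero _ 0 (by simpa using hT f hf)]
      simp
    rw [repairData_eq, messageMatrix_matrixSource ℓ hM, h0, Matrix.mul_zero]
    rfl

/-! ## Entropy of linear random variables -/

section LinearEntropy

variable {F Ω A B : Type*} [Field F] [Fintype F] [AddCommGroup Ω] [Module F Ω] [Finite Ω]
  [AddCommGroup A] [Module F A] [AddCommGroup B] [Module F B]

/-- Every nonempty fibre is a coset of the kernel, so each value has probability q^(-rank). -/
theorem entropy_linearMap (X : Ω →ₗ[F] A) :
    entropy (Fintype.card F) X = Module.finrank F (LinearMap.range X) := by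
  have hfin : Module.Finite F Ω := Module.Finite.of_finite
  have hq : (1 : ℝ) < Fintype.card F := by exact_mod_cast Fintype.one_lt_card
  have hq0 : (Fintype.card F : ℝ) ≠ 0 := by positivity
  have hΩ : Nat.card Ω = Fintype.card F ^ Module.finrank F Ω := by
    rw [Module.natCard_eq_pow_finrank (K := F), Nat.card_eq_fintype_card]
  have hker : Nat.card (LinearMap.ker X) = Fintype.card F ^ Module.finrank F (LinearMap.ker X) := by
    rw [Module.natCard_eq_pow_finrank (K := F), Nat.card_eq_fintype_card]
  have hprob : ∀ ω, -Real.logb (Fintype.card F : ℝ) (uniformProb X (X ω)) =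
      Module.finrank F (LinearMap.range X) := by
    intro ω
    have e : {ω' : Ω // X ω' = X ω} ≃ LinearMap.ker X :=
      { toFun := fun ω' => ⟨ω'.1 - ω, by rw [LinearMap.mem_ker, map_sub, ω'.2, sub_self]⟩
        invFun := fun k => ⟨k.1 + ω, by rw [map_add, LinearMap.mem_ker.1 k.2, zero_add]⟩
        left_inv := fun ω' => Subtype.ext (sub_add_cancel _ _)
        right_inv := fun k => Subtype.ext (add_sub_cancel_right _ _) }
    rw [uniformProb, Nat.card_congr e, hker, hΩ, ← LinearMap.finrank_range_add_finrank_ker X]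
    push_cast
    rw [Real.logb_div (by positivity) (by positivity), Real.logb_pow, Real.logb_pow,
      Real.logb_self_eq_one hq]
    push_cast
    ring
  have := Fintype.ofFinite Ω
  rw [entropy, finsum_congr hprob, finsum_eq_sum_of_fintype, Finset.sum_const, Finset.card_univ,
    ← Nat.card_eq_fintype_card, nsmul_eq_mul, mul_div_cancel_left₀]
  exact_mod_cast Nat.card_pos.ne'

theorem condEntropy_linearMap_eq_zero (X : Ω →ₗ[F] A) (Y : Ω →ₗ[F] B)
    (h : ∀ ω, Y ω = 0 → X ω = 0) : condEntropy (Fintype.card F) X Y = 0 := by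
  have hfin : Module.Finite F Ω := Module.Finite.of_finite
  have h1 := entropy_linearMap (X.prod Y)
  have h2 : LinearMap.ker (X.prod Y) = LinearMap.ker Y := by
    rw [LinearMap.ker_prod]
    exact inf_eq_right.2 h
  have h3 := LinearMap.finrank_range_add_finrank_ker (X.prod Y)
  have h4 := LinearMap.finrank_range_add_finrank_ker Y
  rw [h2] at h3
  have h5 : (fun ω => (X ω, Y ω)) = ⇑(X.prod Y) := rfl
  rw [condEntropy, h5, h1, entropy_linearMap, sub_eq_zero]
  norm_cast
  omega

/-- The hypothesis says that the two kernels span Ω. The dimension formula for their sum and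
intersection then makes the rank of (X, Y) the sum of the ranks. -/
theorem mutualInfo_linearMap_eq_zero (X : Ω →ₗ[F] A) (Y : Ω →ₗ[F] B)
    (h : ∀ ω, ∃ ω', X ω' = X ω ∧ Y ω' = 0) : mutualInfo (Fintype.card F) X Y = 0 := by
  have hfin : Module.Finite F Ω := Module.Finite.of_finite
  have hsup : LinearMap.ker X ⊔ LinearMap.ker Y = ⊤ := by
    rw [eq_top_iff]
    intro ω _
    obtain ⟨ω', h1, h2⟩ := h ω
    rw [← sub_add_cancel ω ω']
    exact Submodule.add_mem_sup (by rw [LinearMap.mem_ker, map_sub, h1, sub_self]) h2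
  have h1 := Submodule.finrank_sup_add_finrank_inf_eq (LinearMap.ker X) (LinearMap.ker Y)
  rw [hsup, finrank_top, ← LinearMap.ker_prod] at h1
  have h2 := LinearMap.finrank_range_add_finrank_ker (X.prod Y)
  have h3 := LinearMap.finrank_range_add_finrank_ker X
  have h4 := LinearMap.finrank_range_add_finrank_ker Y
  have h5 : (fun ω => (X ω, Y ω)) = ⇑(X.prod Y) := rfl
  rw [mutualInfo, h5, entropy_linearMap, entropy_linearMap, entropy_linearMap, sub_eq_zero]
  norm_cast
  omega

/-- A linear random variable which is determined by its coordinates at `c`, a family of `ι` many,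
has entropy at most the number of these coordinates. -/
theorem entropy_linearMap_le {ι : Type*} [Finite ι] {κ : Type*} (X : Ω →ₗ[F] (κ → F))
    (c : ι → κ) (h : ∀ ω, (∀ i, X ω (c i) = 0) → X ω = 0) :
    entropy (Fintype.card F) X ≤ Nat.card ι := by
  have := Fintype.ofFinite ι
  rw [entropy_linearMap]
  let ρ : LinearMap.range X →ₗ[F] (ι → F) :=
    LinearMap.funLeft F F c ∘ₗ (LinearMap.range X).subtype
  have hρ : Function.Injective ρ := by
    rw [← LinearMap.ker_eq_bot, LinearMap.ker_eq_bot']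
    rintro ⟨_, ω, rfl⟩ hω
    exact Subtype.ext (h ω fun i => congrFun hω i)
  have h1 := LinearMap.finrank_le_finrank_of_injective hρ
  rw [Module.finrank_fintype_fun_eq_card, ← Nat.card_eq_fintype_card] at h1
  exact_mod_cast h1

end LinearEntropy

/-! ## The number of secure file symbols -/

theorem Col.insert_removeNth {d m : ℕ} (J : Col d (m + 1)) (i : Fin (m + 1)) :
    insert (J.get i) (J.removeNth i).1 = J.1 :=
  Finset.insert_erase (J.get_mem i)

theorem inBlockD_iff {d m ℓ : ℕ} (J : Col d (m + 1)) (i : Fin (m + 1)) :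
    InBlockD ℓ (J.get i, J.removeNth i) ↔ ∀ y ∈ J.1, ℓ ≤ (y : ℕ) := by
  conv_rhs => rw [← J.insert_removeNth i]
  rw [Finset.forall_mem_insert]
  rfl

theorem card_block (d m ℓ : ℕ) :
    Nat.card {p : Fin d × Col d m // InBlockD ℓ p} = (d - ℓ) * (d - ℓ).choose m := by
  have e : {p : Fin d × Col d m // InBlockD ℓ p} ≃ {y : Fin d // ℓ ≤ (y : ℕ)} × HighCol d m ℓ :=
    { toFun := fun p => ⟨⟨p.1.1, p.2.1⟩, ⟨p.1.2, p.2.2⟩⟩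
      invFun := fun p => ⟨⟨p.1.1, p.2.1⟩, ⟨p.1.2, p.2.2⟩⟩
      left_inv := fun _ => rfl
      right_inv := fun _ => rfl }
  rw [Nat.card_congr e, Nat.card_prod, card_fin_le, card_highCol]

/-- Splitting off the maximum matches these positions with the (m + 1)-sets whose elements are all
at least ℓ. -/
theorem card_block_parity (d m ℓ : ℕ) :
    Nat.card {p : Fin d × Col d m // ¬ (TypeV p ∨ TypeW p) ∧ InBlockD ℓ p} =
      (d - ℓ).choose (m + 1) := by
  rw [← card_highCol]
  symm
  refine Nat.card_congr (Equiv.ofBijective (fun J => ⟨(J.1.get (Fin.last m),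
    J.1.removeNth (Fin.last m)), not_source_last J.1, (inBlockD_iff _ _).2 J.2⟩) ⟨?_, ?_⟩)
  · intro J J' h
    have h' := Prod.ext_iff.1 (Subtype.ext_iff.1 h)
    apply Subtype.ext
    apply Subtype.ext
    rw [← J.1.insert_removeNth (Fin.last m), ← J'.1.insert_removeNth (Fin.last m)]
    have h1 : J.1.get (Fin.last m) = J'.1.get (Fin.last m) := h'.1
    have h2 : J.1.removeNth (Fin.last m) = J'.1.removeNth (Fin.last m) := h'.2
    rw [h1, h2]
  · rintro ⟨⟨x, I⟩, h, hD⟩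
    obtain ⟨J, rfl, rfl⟩ := exists_eq_last_of_not_source h
    exact ⟨⟨J, (inBlockD_iff _ _).1 hD⟩, rfl⟩

theorem mul_choose_eq (k m : ℕ) :
    m * (k + 1).choose (m + 1) + k.choose (m + 1) = k * k.choose m := by
  have h := Nat.choose_succ_right_eq k m
  rw [Nat.choose_succ_succ]
  -- The identity `h` contains the truncated difference k - m; for k < m all binomials involved are
  -- zero.
  rcases le_or_gt m k with hm | hm
  · obtain ⟨j, rfl⟩ := Nat.exists_eq_add_of_le hm
    rw [Nat.add_sub_cancel_left] at h
    nlinarith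
  · rw [Nat.choose_eq_zero_of_lt hm, Nat.choose_eq_zero_of_lt (by omega : k < m + 1)]
    simp

/-- Remove the parity positions from the whole block and apply `mul_choose_eq` with k = d - ℓ. -/
theorem card_securePos (d m ℓ : ℕ) :
    Nat.card (SecurePos d m ℓ) = m * (d - ℓ + 1).choose (m + 1) := by
  classical
  have e : {p : Fin d × Col d m // InBlockD ℓ p} ≃
      SecurePos d m ℓ ⊕ {p : Fin d × Col d m // ¬ (TypeV p ∨ TypeW p) ∧ InBlockD ℓ p} :=
    (Equiv.sumCompl fun p : {p : Fin d × Col d m // InBlockD ℓ p} => TypeV p.1 ∨ TypeW p.1).symm.trans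
      (Equiv.sumCongr
        ((Equiv.subtypeSubtypeEquivSubtypeInter _ fun p => TypeV p ∨ TypeW p).trans
          (Equiv.subtypeEquivRight fun _ => and_comm))
        ((Equiv.subtypeSubtypeEquivSubtypeInter _ fun p => ¬ (TypeV p ∨ TypeW p)).trans
          (Equiv.subtypeEquivRight fun _ => and_comm)))
  have h := Nat.card_congr e
  rw [Nat.card_sum, card_block, card_block_parity, ← mul_choose_eq] at h
  omega

/-! ## Linear regenerating codes -/

section LinearCode

variable {F Ω : Type*} [Field F] [Fintype F] [AddCommGroup Ω] [Module F Ω] [Finite Ω]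

/-- For linear codes every decodability condition is an inclusion of kernels. The family `c` selects
coordinates that determine the repair data, so the bandwidth is their number, not the full length of
the vector. -/
theorem isExactRepairCode_of_linear {σ ν ρ ι : Type*} [Finite σ] [Finite ν] [Finite ι]
    {n k d : ℕ} (S : Ω →ₗ[F] (σ → F)) (N : Fin n → Ω →ₗ[F] (ν → F))
    (R : Fin n → Fin n → Ω →ₗ[F] (ρ → F)) (c : ι → ρ) (hS : Function.Surjective S)
    (hrec : ∀ K : Finset (Fin n), K.card = k → ∀ ω, (∀ i ∈ K, N i ω = 0) → S ω = 0)
    (henc : ∀ h f ω, N h ω = 0 → R h f ω = 0)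
    (hsize : ∀ h f ω, (∀ i, R h f ω (c i) = 0) → R h f ω = 0)
    (hrep : ∀ f, ∀ H : Finset (Fin n), H.card = d → ∀ ω,
      (∀ h ∈ H, R h f ω = 0) → N f ω = 0) :
    IsExactRepairCode (Fintype.card F) n k d (Nat.card ν) (Nat.card ι) (Nat.card σ)
      S (fun i => N i) (fun h f => R h f) where
  message_size := by
    have := Fintype.ofFinite σ
    rw [entropy_linearMap, LinearMap.range_eq_top.2 hS, finrank_top,
      Module.finrank_fintype_fun_eq_card, Nat.card_eq_fintype_card]
  node_size i := entropy_linearMap_le (N i) id fun _ h => funext h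
  data_recovery K hK :=
    condEntropy_linearMap_eq_zero S (LinearMap.pi fun i : K => N i) fun ω h =>
      hrec K hK ω fun i hi => congrFun h ⟨i, hi⟩
  repair_encoder f h _ := condEntropy_linearMap_eq_zero (R h f) (N h) (henc h f)
  repair_size f h _ := entropy_linearMap_le (R h f) c (hsize h f)
  node_repair f H _ hH :=
    condEntropy_linearMap_eq_zero (N f) (LinearMap.pi fun h : H => R h f) fun ω h0 =>
      hrep f H hH ω fun h hh => congrFun h0 ⟨h, hh⟩

theorem isTypeIISecure_of_linear {σ ρ : Type*} {n ℓ : ℕ} (S : Ω →ₗ[F] (σ → F))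
    (R : Fin n → Fin n → Ω →ₗ[F] (ρ → F))
    (h : ∀ L : Finset (Fin n), L.card ≤ ℓ → ∀ ω, ∃ ω', S ω' = S ω ∧
      ∀ f ∈ L, ∀ h, R h f ω' = 0) :
    IsTypeIISecure (Fintype.card F) n ℓ S (fun h f => R h f) := by
  intro L hL
  refine mutualInfo_linearMap_eq_zero S (LinearMap.pi
    fun e : {e : Fin n × Fin n // e.2 ∈ L ∧ e.1 ≠ e.2} => R e.1.1 e.1.2) fun ω => ?_
  obtain ⟨ω', h1, h2⟩ := h L hL ω
  exact ⟨ω', h1, funext fun e => h2 _ e.2.1 _⟩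

theorem IsExactRepairCode.mono {Ω A B C : Type*} [Finite Ω] {q n k d : ℕ} {α β α' β' Fs : ℝ}
    {S : Ω → A} {N : Fin n → Ω → B} {R : Fin n → Fin n → Ω → C}
    (h : IsExactRepairCode q n k d α β Fs S N R) (hα : α ≤ α') (hβ : β ≤ β') :
    IsExactRepairCode q n k d α' β' Fs S N R :=
  { h with
    node_size := fun i => (h.node_size i).trans hα
    repair_size := fun f i hi => (h.repair_size f i hi).trans hβ }

end LinearCode

/-! ## Secure determinant codes -/

/-- The content of a node as a linear function of the secure symbols and the keys. -/
def nodeLinear {n d m ℓ : ℕ} (x : Fin n → F) (i : Fin n) :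
    Source F d m ℓ →ₗ[F] (Col d m → F) where
  toFun s := codeMatrix x s i
  map_add' s s' := by
    have h := (messageMatrixLinear F d m ℓ).map_add s s'
    have h' : codeMatrix x (s + s') = codeMatrix x s + codeMatrix x s' := by
      rw [codeMatrix, codeMatrix, codeMatrix, ← Matrix.mul_add]
      exact congrArg _ h
    rw [h']
    rfl
  map_smul' c s := by
    have h := (messageMatrixLinear F d m ℓ).map_smul c s
    have h' : codeMatrix x (c • s) = c • codeMatrix x s := by
      rw [codeMatrix, codeMatrix, ← Matrix.mul_smul]
      exact congrArg _ h
    rw [h']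
    rfl

/-- The repair data as a linear function of the secure symbols and the keys. -/
def repairLinear {n d m ℓ : ℕ} (x : Fin n → F) (h f : Fin n) :
    Source F d m ℓ →ₗ[F] (Col d (m - 1) → F) :=
  (repairEncoder d m x f).vecMulLinear ∘ₗ nodeLinear x h

theorem eq_zero_of_codeMatrix {n d m ℓ : ℕ} {x : Fin n → F} (hx : Function.Injective x)
    {K : Finset (Fin n)} (hK : K.card = d) {s : Source F d m ℓ}
    (h : ∀ i ∈ K, codeMatrix x s i = 0) : s = 0 := by
  have h1 := inv_encoderMatrix_mul hx (K.orderEmbOfFin hK).injective (messageMatrix s)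
  have h2 : (encoderMatrix d x * messageMatrix s).submatrix (K.orderEmbOfFin hK) id = 0 := by
    ext j I
    exact congrFun (h _ (K.orderEmbOfFin_mem hK j)) I
  rw [h2, Matrix.mul_zero] at h1
  rw [← matrixSource_messageMatrix s, ← h1]
  rfl

theorem repairData_eq_zero_of_highCol {n d m ℓ : ℕ} (hm : 1 ≤ m) (hd : m ≤ d) (x : Fin n → F)
    (h f : Fin n) (s : Source F d m ℓ)
    (h0 : ∀ J : HighCol d (m - 1) 1, repairData x h f s J.1 = 0) : repairData x h f s = 0 := by
  obtain ⟨m, rfl⟩ := Nat.exists_eq_add_of_le' hm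
  have hz : ∀ y : Fin d, (⟨0, by omega⟩ : Fin d) ≤ y := fun y => Nat.zero_le _
  exact vecMul_repairEncoder_eq_zero x f hz _ fun J hJ =>
    h0 ⟨J, (notMem_iff_one_le hz J.1).1 hJ⟩

/-- The explicit formula for the repair of a node. -/
theorem codeMatrix_eq_sum {n d m ℓ : ℕ} (hm : 1 ≤ m) {x : Fin n → F}
    (hx : Function.Injective x) (s : Source F d m ℓ) (f : Fin n) {e : Fin d → Fin n}
    (he : Function.Injective e) (I : Col d m) :
    codeMatrix x s f I = ∑ y : I.1, (-1) ^ ind I.1 y *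
      (((encoderMatrix d x).submatrix e id)⁻¹ *
        Matrix.of (fun j => repairData x (e j) f s)) y (eraseCol I y) := by
  have h1 : Matrix.of (fun j => repairData x (e j) f s) =
      (encoderMatrix d x * (messageMatrix s * repairEncoder d m x f)).submatrix e id := by
    ext j J
    rw [Matrix.of_apply, repairData_eq]
    rfl
  rw [h1, inv_encoderMatrix_mul hx he]
  obtain ⟨m, rfl⟩ := Nat.exists_eq_add_of_le' hm
  exact (isParity_messageMatrix s).vecMul_eq_sum x f I

theorem codeMatrix_eq_zero_of_repairData {n d m ℓ : ℕ} (hm : 1 ≤ m) {x : Fin n → F}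
    (hx : Function.Injective x) {s : Source F d m ℓ} {f : Fin n} {H : Finset (Fin n)}
    (hH : H.card = d) (h : ∀ i ∈ H, repairData x i f s = 0) : codeMatrix x s f = 0 := by
  funext I
  have h0 : Matrix.of (fun j => repairData x (H.orderEmbOfFin hH j) f s) = 0 := by
    ext j J
    exact congrFun (h _ (H.orderEmbOfFin_mem hH j)) J
  rw [codeMatrix_eq_sum hm hx s f (H.orderEmbOfFin hH).injective, h0, Matrix.mul_zero]
  exact Finset.sum_eq_zero fun y _ => mul_zero _

theorem repairData_eq_zero_of_codeMatrix {n d m ℓ : ℕ} {x : Fin n → F} {s : Source F d m ℓ}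
    {h : Fin n} (f : Fin n) (h0 : codeMatrix x s h = 0) : repairData x h f s = 0 := by
  rw [repairData, h0, Matrix.zero_vecMul]

theorem exists_source_repairData_eq_zero {n d m ℓ : ℕ} (hm : 1 ≤ m) {x : Fin n → F}
    (hx : Function.Injective x) (hℓ : ℓ ≤ d) {L : Finset (Fin n)} (hL : L.card ≤ ℓ)
    (s₀ : SecurePos d m ℓ → F) :
    ∃ s : Source F d m ℓ, s.1 = s₀ ∧ ∀ f ∈ L, ∀ h, repairData x h f s = 0 := by
  obtain ⟨m, rfl⟩ := Nat.exists_eq_add_of_le' hm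
  exact exists_keys hx hℓ L hL s₀

/-! ### Space sharing, reduced to the component codes -/

/-- The projection to a component code as a linear map. -/
def componentLinear (F : Type*) [Field F] {d ℓ r : ℕ} (μ : Fin r → ℕ) (j : Fin r) :
    SharedSource F d ℓ μ →ₗ[F] Source F d (μ j) ℓ where
  toFun s := s.component j
  map_add' _ _ := rfl
  map_smul' _ _ := rfl

/-- The content of a node, in all component codes, as a linear map. -/
def sharedNodeLinear {n d ℓ r : ℕ} {μ : Fin r → ℕ} (x : Fin n → F) (i : Fin n) :
    SharedSource F d ℓ μ →ₗ[F] ((Σ j, Col d (μ j)) → F) :=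
  LinearMap.pi fun c => LinearMap.proj c.2 ∘ₗ nodeLinear x i ∘ₗ componentLinear F μ c.1

/-- The repair data, in all component codes, as a linear map. -/
def sharedRepairLinear {n d ℓ r : ℕ} {μ : Fin r → ℕ} (x : Fin n → F) (h f : Fin n) :
    SharedSource F d ℓ μ →ₗ[F] ((Σ j, Col d (μ j - 1)) → F) :=
  LinearMap.pi fun c => LinearMap.proj c.2 ∘ₗ repairLinear x h f ∘ₗ componentLinear F μ c.1

theorem sharedNode_eq_zero_iff {n d ℓ r : ℕ} {μ : Fin r → ℕ} {x : Fin n → F} {i : Fin n}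
    {s : SharedSource F d ℓ μ} :
    sharedNode x i s = 0 ↔ ∀ j, codeMatrix x (s.component j) i = 0 :=
  ⟨fun h j => funext fun I => congrFun h ⟨j, I⟩, fun h => funext fun c => congrFun (h c.1) c.2⟩

theorem sharedRepairData_eq_zero_iff {n d ℓ r : ℕ} {μ : Fin r → ℕ} {x : Fin n → F}
    {h f : Fin n} {s : SharedSource F d ℓ μ} :
    sharedRepairData x h f s = 0 ↔ ∀ j, repairData x h f (s.component j) = 0 :=
  ⟨fun h j => funext fun I => congrFun h ⟨j, I⟩, fun h => funext fun c => congrFun (h c.1) c.2⟩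

section

variable [Fintype F]

theorem isExactRepairCode_determinant {n d m ℓ : ℕ} (hm : 1 ≤ m) (hd : m ≤ d) {x : Fin n → F}
    (hx : Function.Injective x) :
    IsExactRepairCode (Fintype.card F) n d d
      (d.choose m : ℝ) ((d - 1).choose (m - 1) : ℝ) ((m * (d - ℓ + 1).choose (m + 1) : ℕ) : ℝ)
      (fun s : Source F d m ℓ => s.1) (fun i s => codeMatrix x s i)
      (fun h f s => repairData x h f s) := by
  have h := isExactRepairCode_of_linear (k := d) (d := d)
    (LinearMap.fst F (SecurePos d m ℓ → F) (KeyPos d m ℓ → F)) (nodeLinear x) (repairLinear x)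
    (fun J : HighCol d (m - 1) 1 => J.1) LinearMap.fst_surjective
    (fun K hK s h => by rw [eq_zero_of_codeMatrix hx hK h]; rfl)
    (fun h f s h0 => repairData_eq_zero_of_codeMatrix f h0)
    (fun h f s h0 => repairData_eq_zero_of_highCol hm hd x h f s h0)
    (fun f H hH s h0 => codeMatrix_eq_zero_of_repairData hm hx hH h0)
  rw [card_col, card_highCol, card_securePos] at h
  exact h

theorem isTypeIISecure_determinant {n d m ℓ : ℕ} (hm : 1 ≤ m) (hℓ : ℓ ≤ d) {x : Fin n → F}
    (hx : Function.Injective x) :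
    IsTypeIISecure (Fintype.card F) n ℓ
      (fun s : Source F d m ℓ => s.1) (fun h f s => repairData x h f s) :=
  isTypeIISecure_of_linear (LinearMap.fst F (SecurePos d m ℓ → F) (KeyPos d m ℓ → F))
    (repairLinear x) fun _ hL s => exists_source_repairData_eq_zero hm hx hℓ hL s.1

theorem isExactRepairCode_shared {n d ℓ r : ℕ} {μ : Fin r → ℕ} (hμ : ∀ j, 1 ≤ μ j ∧ μ j ≤ d)
    {x : Fin n → F} (hx : Function.Injective x) :
    IsExactRepairCode (Fintype.card F) n d d
      (∑ j, (d.choose (μ j) : ℝ)) (∑ j, ((d - 1).choose (μ j - 1) : ℝ))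
      (∑ j, ((μ j * (d - ℓ + 1).choose (μ j + 1) : ℕ) : ℝ))
      (fun s : SharedSource F d ℓ μ => s.1) (fun i s => sharedNode x i s)
      (fun h f s => sharedRepairData x h f s) := by
  have h := isExactRepairCode_of_linear (k := d) (d := d)
    (LinearMap.fst F ((Σ j, SecurePos d (μ j) ℓ) → F) ((Σ j, KeyPos d (μ j) ℓ) → F))
    (sharedNodeLinear x) (sharedRepairLinear x)
    (fun c : Σ j, HighCol d (μ j - 1) 1 => ⟨c.1, c.2.1⟩) LinearMap.fst_surjective
    (fun K hK s h => by
      funext p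
      have h0 : SharedSource.component (μ := μ) s p.1 = 0 := eq_zero_of_codeMatrix hx hK fun i hi =>
        sharedNode_eq_zero_iff.1 (h i hi) p.1
      exact congrFun (congrArg Prod.fst h0) p.2)
    (fun h f s h0 => sharedRepairData_eq_zero_iff.2 fun j =>
      repairData_eq_zero_of_codeMatrix f (sharedNode_eq_zero_iff.1 h0 j))
    (fun h f s h0 => sharedRepairData_eq_zero_iff.2 fun j =>
      repairData_eq_zero_of_highCol (hμ j).1 (hμ j).2 x h f _ fun J => h0 ⟨j, J⟩)
    (fun f H hH s h0 => sharedNode_eq_zero_iff.2 fun j =>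
      codeMatrix_eq_zero_of_repairData (hμ j).1 hx hH fun i hi =>
        sharedRepairData_eq_zero_iff.1 (h0 i hi) j)
  simp only [Nat.card_sigma, card_col, card_highCol, card_securePos, Nat.cast_sum] at h
  exact h

theorem isTypeIISecure_shared {n d ℓ r : ℕ} {μ : Fin r → ℕ} (hμ : ∀ j, 1 ≤ μ j)
    (hℓ : ℓ ≤ d) {x : Fin n → F} (hx : Function.Injective x) :
    IsTypeIISecure (Fintype.card F) n ℓ
      (fun s : SharedSource F d ℓ μ => s.1) (fun h f s => sharedRepairData x h f s) := by
  refine isTypeIISecure_of_linear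
    (LinearMap.fst F ((Σ j, SecurePos d (μ j) ℓ) → F) ((Σ j, KeyPos d (μ j) ℓ) → F))
    (sharedRepairLinear x) fun L hL s => ?_
  -- Keys hiding each component message are chosen separately and then glued.
  choose s' hs' h0 using fun j =>
    exists_source_repairData_eq_zero (hμ j) hx hℓ hL (SharedSource.component (μ := μ) s j).1
  refine ⟨(fun p => (s' p.1).1 p.2, fun p => (s' p.1).2 p.2), ?_, fun f hf h => ?_⟩
  · funext p
    exact congrFun (hs' p.1) p.2
  · exact sharedRepairData_eq_zero_iff.2 fun j => h0 j f hf h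

/-! ## Achievability -/

theorem exists_evaluation_points {n : ℕ} (hq : n < Fintype.card F) :
    ∃ x : Fin n → F, Function.Injective x ∧ ∀ i, x i ≠ 0 := by
  classical
  have h : Fintype.card (Fin n) ≤ Fintype.card Fˣ := by
    rw [Fintype.card_fin, Fintype.card_units]
    omega
  obtain ⟨g⟩ := Function.Embedding.nonempty_of_card_le h
  exact ⟨fun i => g i, Units.val_injective.comp g.injective, fun i => (g i).ne_zero⟩

theorem isAchievable_of_weights {n d ℓ : ℕ} (hℓ : ℓ ≤ d) {x : Fin n → F}
    (hx : Function.Injective x) {ι : Type*} [Fintype ι] (w : ι → ℝ) (hw : ∀ i, 0 ≤ w i)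
    (m : ι → ℕ) (hm : ∀ i, 1 ≤ m i ∧ m i ≤ d) :
    IsAchievable F n d d ℓ (∑ i, w i * (d.choose (m i) : ℝ))
      (∑ i, w i * ((d - 1).choose (m i - 1) : ℝ))
      (∑ i, w i * ((m i * (d - ℓ + 1).choose (m i + 1) : ℕ) : ℝ)) := by
  intro ε hε
  let G : ι → ℝ := fun i => ((m i * (d - ℓ + 1).choose (m i + 1) : ℕ) : ℝ)
  -- Rounding down loses at most one copy of each code, that is at most ∑ G symbols in total; T is
  -- taken large enough for T ε to cover this loss.
  obtain ⟨T₀, hT₀⟩ := exists_nat_gt ((∑ i, G i) / ε)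
  let T : ℕ := T₀ + 1
  have hT : ∑ i, G i ≤ T * ε := by
    have h1 := (div_lt_iff₀ hε).1 hT₀
    have h2 : (T : ℝ) = T₀ + 1 := by simp [T]
    rw [h2]
    nlinarith
  -- The number of copies of code i: rounding down keeps storage and bandwidth within T α and T β.
  let c : ι → ℕ := fun i => ⌊(T : ℝ) * w i⌋₊
  have hc : ∀ i, (c i : ℝ) ≤ T * w i := fun i =>
    Nat.floor_le (mul_nonneg (Nat.cast_nonneg T) (hw i))
  have hc' : ∀ i, (T : ℝ) * w i ≤ c i + 1 := fun i => (Nat.lt_floor_add_one _).le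
  let e := (Fintype.equivFin (Σ i, Fin (c i))).symm
  have hsum : ∀ g : ι → ℝ, ∑ j, g (e j).1 = ∑ i, c i * g i := by
    intro g
    rw [e.sum_comp fun p => g p.1, Fintype.sum_sigma]
    simp
  have hle : ∀ g : ι → ℝ, (∀ i, 0 ≤ g i) → ∑ j, g (e j).1 ≤ T * ∑ i, w i * g i := by
    intro g hg
    rw [hsum, Finset.mul_sum]
    refine Finset.sum_le_sum fun i _ => ?_
    rw [← mul_assoc]
    exact mul_le_mul_of_nonneg_right (hc i) (hg i)
  refine ⟨T, Nat.succ_pos _, ∑ j, G (e j).1, ?_, ?_⟩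
  · rw [hsum, mul_sub, Finset.mul_sum]
    have h1 : ∑ i, (T : ℝ) * (w i * G i) ≤ ∑ i, (c i * G i + G i) := by
      refine Finset.sum_le_sum fun i _ => ?_
      have := mul_le_mul_of_nonneg_right (hc' i) (Nat.cast_nonneg (α := ℝ)
        (m i * (d - ℓ + 1).choose (m i + 1)))
      change (T : ℝ) * w i * G i ≤ (c i + 1) * G i at this
      linarith
    rw [Finset.sum_add_distrib] at h1
    linarith
  · have h := (isExactRepairCode_shared (ℓ := ℓ) (μ := fun j => m (e j).1) (fun j => hm _) hx).mono
      (hle (fun i => (d.choose (m i) : ℝ)) fun i => Nat.cast_nonneg _)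
      (hle (fun i => ((d - 1).choose (m i - 1) : ℝ)) fun i => Nat.cast_nonneg _)
    exact ⟨Σ j, SecurePos d (m (e j).1) ℓ, Σ j, KeyPos d (m (e j).1) ℓ,
      Σ j, Col d (m (e j).1), Σ j, Col d (m (e j).1 - 1), inferInstance, inferInstance,
      inferInstance, inferInstance, sharedNode x, sharedRepairData x, h,
      isTypeIISecure_shared (fun j => (hm _).1) hℓ hx⟩

end

end

theorem theorem2 {F : Type*} [Field F] [Fintype F] (n d ℓ : ℕ) (hℓ : ℓ ≤ d) (hd : d < n)
    (hq : n < Fintype.card F) :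
    -- evaluation points for the encoder matrix exist
    (∃ x : Fin n → F, Function.Injective x ∧ ∀ i, x i ≠ 0) ∧
    (∀ x : Fin n → F, Function.Injective x → (∀ i, x i ≠ 0) →
      -- the secure determinant code of mode `m`
      (∀ m : ℕ, 1 ≤ m → m ≤ d →
        IsExactRepairCode (Fintype.card F) n d d
          (d.choose m : ℝ) ((d - 1).choose (m - 1) : ℝ) ((m * (d - ℓ + 1).choose (m + 1) : ℕ) : ℝ)
          (fun s : Source F d m ℓ => s.1) (fun i s => codeMatrix x s i)
          (fun h f s => repairData x h f s) ∧
        IsTypeIISecure (Fintype.card F) n ℓ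
          (fun s : Source F d m ℓ => s.1) (fun h f s => repairData x h f s) ∧
        -- the repair data is determined by `β` of its entries
        (∀ f : Fin n, (repairEncoder d m x f).rank = (d - 1).choose (m - 1)) ∧
        -- explicit linear data recovery
        (∀ (s : Source F d m ℓ) (e : Fin d → Fin n), Function.Injective e →
          ((encoderMatrix d x).submatrix e id)⁻¹ * (codeMatrix x s).submatrix e id
            = messageMatrix s) ∧
        -- explicit linear node repair
        (∀ (s : Source F d m ℓ) (f : Fin n) (e : Fin d → Fin n), Function.Injective e →
          (∀ j, e j ≠ f) → ∀ I : Col d m,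
          codeMatrix x s f I = ∑ y : I.1, (-1) ^ ind I.1 y *
            (((encoderMatrix d x).submatrix e id)⁻¹ *
              Matrix.of (fun j => repairData x (e j) f s)) y (eraseCol I y))) ∧
      -- space sharing between secure determinant codes
      (∀ (r : ℕ) (μ : Fin r → ℕ), (∀ j, 1 ≤ μ j ∧ μ j ≤ d) →
        IsExactRepairCode (Fintype.card F) n d d
          (∑ j, (d.choose (μ j) : ℝ)) (∑ j, ((d - 1).choose (μ j - 1) : ℝ))
          (∑ j, ((μ j * (d - ℓ + 1).choose (μ j + 1) : ℕ) : ℝ))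
          (fun s : SharedSource F d ℓ μ => s.1) (fun i s => sharedNode x i s)
          (fun h f s => sharedRepairData x h f s) ∧
        IsTypeIISecure (Fintype.card F) n ℓ
          (fun s : SharedSource F d ℓ μ => s.1) (fun h f s => sharedRepairData x h f s))) ∧
    -- the convex hull of the tuples is achievable
    (∀ t ∈ convexHull ℝ {t : ℝ × ℝ × ℝ | ∃ m : ℕ, 1 ≤ m ∧ m ≤ d ∧
        t = ((d.choose m : ℝ), ((d - 1).choose (m - 1) : ℝ),
          ((m * (d - ℓ + 1).choose (m + 1) : ℕ) : ℝ))},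
      IsAchievable F n d d ℓ t.1 t.2.1 t.2.2) := by
  refine ⟨exists_evaluation_points hq, fun x hx _ => ⟨fun m hm hmd =>
    ⟨isExactRepairCode_determinant hm hmd hx, isTypeIISecure_determinant hm hℓ hx, fun f => ?_,
      fun s e he => inv_encoderMatrix_mul hx he _,
      fun s f e he _ I => codeMatrix_eq_sum hm hx s f he I⟩,
    fun r μ hμ => ⟨isExactRepairCode_shared hμ hx,
      isTypeIISecure_shared (fun j => (hμ j).1) hℓ hx⟩⟩, fun t ht => ?_⟩
  · obtain ⟨m, rfl⟩ := Nat.exists_eq_add_of_le' hm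
    exact rank_repairEncoder (by omega) x f
  · obtain ⟨x, hx, -⟩ := exists_evaluation_points hq
    -- A point of the hull is a finite nonnegative combination of mode tuples, to which space
    -- sharing applies.
    obtain ⟨ι, _, w, z, hw, -, hz, rfl⟩ := mem_convexHull_iff_exists_fintype.1 ht
    choose m hm hmd hzm using hz
    have h := isAchievable_of_weights (n := n) hℓ hx w hw m fun i => ⟨hm i, hmd i⟩
    simpa [hzm, Prod.fst_sum, Prod.snd_sum] using h
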